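/- Consider the chiral open $N=2$ string in the NS sector, with momentum $k\in\mathbb R^{2,2}\cong\mathbb C^{1,1}$, so that $k^{-\mu}=\overline{k^{+\mu}}$ ($\mu=0,1$) and $k\cdot k=\sum_\mu\eta_{\mu\mu}k^{+\mu}k^{-\mu}$, $\eta=\mathrm{diag}(-1,1)$. Its Fock space in the picture $(\pi^+,\pi^-)\in\mathbb Z^2$ at momentum $k$ is the complex vector space generated from the ground state $|\pi^+,\pi^-,k\rangle$ by the modes of the string coordinates, of the matter fermions $d^{\pm\mu}_r$, of the ghosts $(b,c)$ and $(\tilde b,\tilde c)$ of weights $(2,-1)$ and $(1,0)$, and of the bosonic spinor ghosts $(\beta^{\mp},\gamma^{\pm})$, $r\in\mathbb Z+\frac12$; $\gamma^{\pm}_r$ is a creation operator iff $r\le\pi^{\mp}+\frac12$, and otherwise it annihilates the ground state. The ghost number is $+1$ for $c,\tilde c,\gamma^\pm$, $-1$ for $b,\tilde b,\beta^\pm$, and $0$ for the matter modes and for the ground states. Let $Q$ be the BRST operator of the $N=2$ superconformal algebra, with $\{Q,b_0\}=L_0$ and $\{Q,\tilde b_0\}=J_0$. Let $$F^{\pi^+,\pi^-}(k)=\{\psi:\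 L_0\psi=J_0\psi=\tilde b_0\psi=0\},\qquad F_{rel}^{\pi^+,\pi^-}(k)=\{\psi\in F^{\pi^+,\pi^-}(k):\ b_0\psi=0\},$$ graded by the ghost number $g$. The cohomology of $Q$ on $F$ is called absolute, that on $F_{rel}$ relative. For $N\ge 0$ put $$A_N^\mu=c_1(\gamma^+_{1/2})^N(\gamma^-_{-1/2})^N d^{-\mu}_{-1/2}|{-1},0,k\rangle,\qquad B_N=c_1(\gamma^+_{1/2})^N(\gamma^-_{-1/2})^{N+1}|{-1},0,k\rangle,$$ $$C_N=C_N^{01}=c_1(\gamma^+_{1/2})^{N+1}(\gamma^-_{-1/2})^{N}d^{-0}_{-1/2}d^{-1}_{-1/2}|{-1},0,k\rangle .$$ In the $(-1,0)$ picture at $k=0$, and in the $(-1,-1)$ picture at every $k$ with $k\cdot k=0$, $Q$ maps $F$ and $F_{rel}$ to themselves, raises $g$ by one and squares to zero there. Moreover: 1. (Relative, $(-1,0)$, $k=0$.) $Q$ vanishes identically on $F_{rel}^{-1,0}(k=0)$. The relative cohomology is two-dimensional at every ghost number $g\ge 1$ and zero at every $g\le 0$; for every $N\ge 0$ a basis is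 given by the classes of $A_N^0,A_N^1$ at $g=2N+1$ and by those of $B_N,C_N$ at $g=2N+2$. 2. (Absolute, $(-1,0)$, $k=0$.) $H^{-1,0}(F|k=0)$ has the basis $A_0^0,A_0^1$ at $g=1$ and the basis $B_0,C_0$ at $g=2$, and it vanishes at every other ghost number. 3. ($(-1,-1)$ picture.) For every $k$ with $k\cdot k=0$, including $k=0$, the relative cohomology is spanned by the single non-zero class of $c_1|{-1},{-1},k\rangle$ at $g=1$ and vanishes at $g\ne1$; the absolute cohomology is one-dimensional at $g=1$, spanned by $c_1|{-1},{-1},k\rangle$, one-dimensional at $g=2$, spanned by $c_0c_1|{-1},{-1},k\rangle$, and vanishes at $g\neq 1,2$. Under the identification $|{-1},{-1},k\rangle\leftrightarrow|{-1},{-1},0\rangle$ of the ground states, the closed states and the exact states in $F$ and in $F_{rel}$ at each ghost number are the same at such a $k$ as at $k=0$; that is, the $k=0$ cohomology is the zero-momentum limit of the massless $k\ne0$ cohomology. 4. (Picture dependence.) At $k=0$ the relative cohomologies in the pictures $(-1,0)$ and $(-1,-1)$ are not isomorphic at any ghost number $g\ge1$, and the absolute cohomologies in these two pictures are not isomorphic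 at $g=1$ and at $g=2$. -/

import Mathlib

/-!
The chiral open `N = 2` string in the NS sector: the oscillator Fock space, the BRST charge as the
normal ordered mode sum, and the absolute and relative BRST complexes, for every integral picture
`(π⁺, π⁻)` and every centre-of-mass momentum.

Half-integral mode numbers `r` are written `r = j + 1/2` with `j : ℤ`.

Mode algebra (all other (anti)commutators vanish; `η = diag (-1, 1)`):
* `[a^{+μ}_m, a^{-ν}_n] = 2 m η^{μν} δ_{m+n}`, `a^{±μ}_0 = k^{±μ}` (string coordinates),
* `{d^{+μ}_r, d^{-ν}_s} = 2 η^{μν} δ_{r+s}` (matter fermions),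
* `{c_m, b_n} = δ_{m+n}`, `{c̃_m, b̃_n} = δ_{m+n}` (reparametrisation and `U(1)` ghosts),
* `[γ^±_r, β^∓_s] = δ_{r+s}` (spinor ghosts).
-/

namespace N2String

noncomputable section

/-- The two superscripts `±`. -/
inductive Sgn
  | plus
  | minus
  deriving DecidableEq

namespace Sgn

/-- The opposite sign. -/
def opp : Sgn → Sgn
  | plus => minus
  | minus => plus

/-- The sign as an integer. -/
def val : Sgn → ℤ
  | plus => 1
  | minus => -1

end Sgn

/-- The flat metric `diag (-1, 1)` on `ℂ^{1,1} = ℝ^{2,2}`. -/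
def eta (μ : Fin 2) : ℝ := if μ = 0 then -1 else 1

/-- A momentum `k ∈ ℝ^{2,2} = ℂ^{1,1}`, given by its components `k^{+μ}`; the components
`k^{-μ}` are the complex conjugates. -/
abbrev Momentum := Fin 2 → ℂ

/-- The components `k^{±μ}`. -/
def Momentum.comp (k : Momentum) : Sgn → Fin 2 → ℂ
  | .plus, μ => k μ
  | .minus, μ => (starRingEnd ℂ) (k μ)

/-- `k · k`, normalised as `∑ μ, η_{μμ} k^{+μ} k^{-μ}`. -/
def Momentum.sq (k : Momentum) : ℝ := ∑ μ, eta μ * Complex.normSq (k μ)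

/-- A picture `(π⁺, π⁻)` of the NS sector. -/
structure Picture where
  plus : ℤ
  minus : ℤ

/-- The charge governing the spinor ghost `γ^±`.  The picture vacuum carries the factor
`exp (π⁻ φ⁺ + π⁺ φ⁻)`, and `γ^± = η^± exp φ^±`; hence `γ^+` sees `π⁻` and `γ^-` sees `π⁺`. -/
def Picture.level (π : Picture) : Sgn → ℤ
  | .plus => π.minus
  | .minus => π.plus

/-! ### Occupation numbers -/

/-- The fermionic oscillators.
* `bc n`: the conjugate pair `c_n, b_{-n}`; its creation operator is `c_n` for `n ≤ 1`
  and `b_{-n}` for `n ≥ 2`.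
* `bct n`: the conjugate pair `c̃_n, b̃_{-n}`; its creation operator is `c̃_n` for `n ≤ 0`
  and `b̃_{-n}` for `n ≥ 1`.
* `psi s μ n`: the creation operator `d^{sμ}_{-(n+1/2)}`. -/
inductive FermiMode
  | bc (n : ℤ)
  | bct (n : ℤ)
  | psi (s : Sgn) (μ : Fin 2) (n : ℕ)

/-- The bosonic oscillators.
* `alpha s μ n`: the creation operator `a^{sμ}_{-(n+1)}`.
* `ghost s j`: the conjugate pair `γ^s_r, β^{-s}_{-r}` with `r = j + 1/2`; which of the two is the
  creation operator depends on the picture, see `gammaCreates`. -/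
inductive BoseMode
  | alpha (s : Sgn) (μ : Fin 2) (n : ℕ)
  | ghost (s : Sgn) (j : ℤ)

/-- A numbering of the fermionic oscillators, which fixes their order. -/
def FermiMode.key : FermiMode → ℕ ×ₗ ℤ
  | .bc n => toLex (0, n)
  | .bct n => toLex (1, n)
  | .psi .plus μ n => toLex (2 + μ.val, (n : ℤ))
  | .psi .minus μ n => toLex (4 + μ.val, (n : ℤ))

theorem FermiMode.key_injective : Function.Injective FermiMode.key := by
  intro x y h
  rcases x with n | n | ⟨s, μ, n⟩ <;> rcases y with m | m | ⟨t, ν, m⟩ <;>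
    (try cases s) <;> (try cases t) <;>
    simp only [FermiMode.key, EmbeddingLike.apply_eq_iff_eq, Prod.mk.injEq] at h <;>
    first
    | (exfalso; omega)
    | (obtain ⟨h1, h2⟩ := h
       first
       | (subst h2; rfl)
       | (have e1 : μ = ν := Fin.ext (by omega)
          have e2 : n = m := by omega
          subst e1; subst e2; rfl))

instance : LinearOrder FermiMode := LinearOrder.lift' FermiMode.key FermiMode.key_injective

/-- An occupation of the oscillators: the set of occupied fermionic ones and the occupation
numbers of the bosonic ones. -/
abbrev Occ := Finset FermiMode × (BoseMode →₀ ℕ)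

/-- The Fock space over the ground state `|π⁺, π⁻, k⟩`, with its occupation number basis. -/
abbrev Fock := Occ →₀ ℂ

instance : AddCommGroup Fock := Finsupp.instAddCommGroup

/-- Linear operators on the Fock space. -/
abbrev Op := Module.End ℂ Fock

/-- The ground state `|π⁺, π⁻, k⟩`. -/
def vac : Fock := Finsupp.single ((∅ : Finset FermiMode), (0 : BoseMode →₀ ℕ)) 1

/-- The operator with prescribed values on the occupation number basis. -/
def onBasis (f : Occ → Fock) : Op := Finsupp.linearCombination ℂ f

/-- The sign `(-1)^{number of occupied fermionic oscillators before i}`. -/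
def fermiSign (S : Finset FermiMode) (i : FermiMode) : ℂ := (-1) ^ (S.filter (· < i)).card

/-- Fermionic creation operator. -/
def createF (i : FermiMode) : Op := onBasis fun e =>
  if i ∈ e.1 then 0 else Finsupp.single (insert i e.1, e.2) (fermiSign e.1 i)

/-- Fermionic annihilation operator, `{annihF i, createF j} = δ_{ij}`. -/
def annihF (i : FermiMode) : Op := onBasis fun e =>
  if i ∈ e.1 then Finsupp.single (e.1.erase i, e.2) (fermiSign e.1 i) else 0

/-- Bosonic creation operator. -/
def createB (i : BoseMode) : Op := onBasis fun e =>
  Finsupp.single (e.1, e.2 + Finsupp.single i 1) 1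

/-- Bosonic annihilation operator, `[annihB i, createB j] = δ_{ij}`. -/
def annihB (i : BoseMode) : Op := onBasis fun e =>
  Finsupp.single (e.1, e.2 - Finsupp.single i 1) (e.2 i : ℂ)

/-! ### The modes of the fields -/

/-- `c_n`. -/
def c (n : ℤ) : Op := if n ≤ 1 then createF (.bc n) else annihF (.bc n)

/-- `b_n`. -/
def b (n : ℤ) : Op := if n ≤ -2 then createF (.bc (-n)) else annihF (.bc (-n))

/-- `c̃_n`. -/
def ct (n : ℤ) : Op := if n ≤ 0 then createF (.bct n) else annihF (.bct n)

/-- `b̃_n`. -/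
def bt (n : ℤ) : Op := if n ≤ -1 then createF (.bct (-n)) else annihF (.bct (-n))

/-- `d^{sμ}_r`, `r = j + 1/2`. -/
def d (s : Sgn) (μ : Fin 2) : ℤ → Op
  | .ofNat n => ((2 * eta μ : ℝ) : ℂ) • annihF (.psi s.opp μ n)
  | .negSucc n => createF (.psi s μ n)

/-- `a^{sμ}_m`, with `a^{sμ}_0 = k^{sμ}`. -/
def a (k : Momentum) (s : Sgn) (μ : Fin 2) : ℤ → Op
  | .ofNat 0 => k.comp s μ • 1
  | .ofNat (n + 1) => ((2 * (n + 1 : ℕ) * eta μ : ℝ) : ℂ) • annihB (.alpha s.opp μ n)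
  | .negSucc n => createB (.alpha s μ n)

/-- In the given picture `γ^s_r`, `r = j + 1/2`, is a creation operator if and only if
`r ≤ level + 1/2`; otherwise it annihilates the ground state and its conjugate
`β^{-s}_{-r}` is a creation operator. -/
abbrev gammaCreates (π : Picture) (s : Sgn) (j : ℤ) : Prop := j ≤ π.level s

/-- `γ^s_r`, `r = j + 1/2`. -/
def gam (π : Picture) (s : Sgn) (j : ℤ) : Op :=
  if gammaCreates π s j then createB (.ghost s j) else annihB (.ghost s j)

/-- `β^s_r`, `r = j + 1/2`; it is conjugate to `γ^{-s}_{-r}`, and `-r = (-j-1) + 1/2`. -/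
def bet (π : Picture) (s : Sgn) (j : ℤ) : Op :=
  if gammaCreates π s.opp (-j - 1) then -annihB (.ghost s.opp (-j - 1))
  else createB (.ghost s.opp (-j - 1))

/-! ### Conformal weight, `U(1)` charge and ghost number

These operators are diagonal in the occupation number basis. -/

/-- The contribution of a fermionic creation operator to `L_0`. -/
def FermiMode.energy : FermiMode → ℝ
  | .bc n => if n ≤ 1 then -n else n
  | .bct n => if n ≤ 0 then -n else n
  | .psi _ _ n => n + 1 / 2

/-- The contribution of a bosonic creation operator to `L_0`. -/
def BoseMode.energy (π : Picture) : BoseMode → ℝ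
  | .alpha _ _ n => n + 1
  | .ghost s j => if gammaCreates π s j then -(j + 1 / 2) else j + 1 / 2

/-- The contribution of a fermionic creation operator to `J_0`. -/
def FermiMode.charge : FermiMode → ℤ
  | .bc _ => 0
  | .bct _ => 0
  | .psi s _ _ => s.val

/-- The contribution of a bosonic creation operator to `J_0`; the string coordinates are neutral,
`γ^±` and `β^±` have charge `±1`. -/
def BoseMode.charge (π : Picture) : BoseMode → ℤ
  | .alpha _ _ _ => 0
  | .ghost s j => if gammaCreates π s j then s.val else -s.val

/-- The ghost number of a fermionic creation operator. -/
def FermiMode.ghostNumber : FermiMode → ℤ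
  | .bc n => if n ≤ 1 then 1 else -1
  | .bct n => if n ≤ 0 then 1 else -1
  | .psi _ _ _ => 0

/-- The ghost number of a bosonic creation operator. -/
def BoseMode.ghostNumber (π : Picture) : BoseMode → ℤ
  | .alpha _ _ _ => 0
  | .ghost s j => if gammaCreates π s j then 1 else -1

/-- The conformal weight of the ground state at zero momentum: `exp (q φ)` has weight
`-q²/2 - q`. -/
def vacWeight (π : Picture) : ℝ :=
  (-(π.plus : ℝ) ^ 2 / 2 - π.plus) + (-(π.minus : ℝ) ^ 2 / 2 - π.minus)

/-- The `U(1)` charge of the ground state: `exp (q φ^±)` has charge `±q`. -/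
def vacCharge (π : Picture) : ℤ := π.minus - π.plus

/-- The `L_0` eigenvalue of a basis state. -/
def weight (π : Picture) (k : Momentum) (e : Occ) : ℝ :=
  vacWeight π + k.sq / 2 + ∑ i ∈ e.1, i.energy + e.2.sum fun i n => (n : ℝ) * i.energy π

/-- The `J_0` eigenvalue of a basis state. -/
def charge (π : Picture) (e : Occ) : ℤ :=
  vacCharge π + ∑ i ∈ e.1, i.charge + e.2.sum fun i n => (n : ℤ) * i.charge π

/-- The ghost number of a basis state; all ground states have ghost number zero. -/
def ghostNumber (π : Picture) (e : Occ) : ℤ :=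
  ∑ i ∈ e.1, i.ghostNumber + e.2.sum fun i n => (n : ℤ) * i.ghostNumber π

/-- The bosonic zero mode `L_0`. -/
def L0 (π : Picture) (k : Momentum) : Op :=
  onBasis fun e => Finsupp.single e ((weight π k e : ℝ) : ℂ)

/-- The bosonic zero mode `J_0`. -/
def J0 (π : Picture) : Op := onBasis fun e => Finsupp.single e (charge π e : ℂ)

/-- The ghost number operator. -/
def ghostOp (π : Picture) : Op := onBasis fun e => Finsupp.single e (ghostNumber π e : ℂ)

/-! ### The BRST charge

`Q = ∑ c_{-n} L_n + ∑ c̃_{-n} J_n + ∑ γ^+_{-r} G^-_r + ∑ γ^-_{-r} G^+_r + (pure ghost terms)`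
for the `N = 2` algebra with `{G^+_r, G^-_s} = 4 L_{r+s} + 2 (r - s) J_{r+s} + central term`,
`[L_m, G^±_r] = (m/2 - r) G^±_{m+r}`, `[J_m, G^±_r] = ± G^±_{m+r}`.
All products are normal ordered with respect to the picture vacuum; the constants left over are
the weight and the charge of the vacuum, multiplying `c_0` and `c̃_0`. -/

/-- The operator `∑_{m,n} f m n`.  It is used for normal ordered sums only, in which just finitely
many terms act non-trivially on a given occupation number state. -/
def modeSum (f : ℤ → ℤ → Op) : Op :=
  onBasis fun e => ∑ᶠ p : ℤ × ℤ, f p.1 p.2 (Finsupp.single e 1)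

/-- `: a^{+μ}_m a^{-μ}_n :`. -/
def normAA (k : Momentum) (μ : Fin 2) (m n : ℤ) : Op :=
  if n < 0 then a k .minus μ n * a k .plus μ m else a k .plus μ m * a k .minus μ n

/-- `: d^{+μ}_r d^{-μ}_s :` with `r = i + 1/2`, `s = j + 1/2`. -/
def normDD (μ : Fin 2) (i j : ℤ) : Op :=
  if j < 0 then -(d .minus μ j * d .plus μ i) else d .plus μ i * d .minus μ j

/-- `: c_l c_m b_n :`. -/
def normCCB (l m n : ℤ) : Op := if n ≤ -2 then b n * c l * c m else c l * c m * b n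

/-- `: c_l c̃_m b̃_n :`. -/
def normCCtBt (l m n : ℤ) : Op := if n ≤ -1 then bt n * c l * ct m else c l * ct m * bt n

/-- `: γ^{-s}_{r} β^{s}_{t} :` with `r = i + 1/2`, `t = j + 1/2`. -/
def normGB (π : Picture) (s : Sgn) (i j : ℤ) : Op :=
  if gammaCreates π s.opp (-j - 1) then gam π s.opp i * bet π s j
  else bet π s j * gam π s.opp i

/-- `∑ c_{-n} L_n` for the string coordinates, `L_l = ½ ∑ η : a^+_m a^-_{l-m} :`. -/
def qBose (k : Momentum) : Op :=
  modeSum fun m n => ∑ μ, ((eta μ / 2 : ℝ) : ℂ) • (c (-(m + n)) * normAA k μ m n)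

/-- `∑ c_{-n} L_n` for the matter fermions, `L_{r+s} = ¼ ∑ η (s - r) : d^+_r d^-_s :`;
here `r = i + 1/2` and `s = j + 1/2`. -/
def qFermi : Op :=
  modeSum fun i j => ∑ μ, ((eta μ * (j - i) / 4 : ℝ) : ℂ) • (c (-(i + j + 1)) * normDD μ i j)

/-- `∑ c̃_{-n} J_n` for the matter, `J_{r+s} = ½ ∑ η : d^+_r d^-_s :`;
here `r = i + 1/2` and `s = j + 1/2`. -/
def qCurrent : Op :=
  modeSum fun i j => ∑ μ, ((eta μ / 2 : ℝ) : ℂ) • (ct (-(i + j + 1)) * normDD μ i j)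

/-- `∑ γ^s_{-r} G^{-s}_r` for the matter, `G^{-s}_{m+t} = -∑ η a^{s}_m d^{-s}_t`; here
`t = j + 1/2` and `-r = -(m+t) = -(m+j+1) + 1/2`. -/
def qSuper (π : Picture) (k : Momentum) (s : Sgn) : Op :=
  modeSum fun m j =>
    -∑ μ, ((eta μ : ℝ) : ℂ) • (gam π s (-(m + j + 1)) * a k s μ m * d s.opp μ j)

/-- `-½ ∑ (m - n) : c_{-m} c_{-n} b_{m+n} :`. -/
def qCCB : Op :=
  modeSum fun m n => (-((m : ℂ) - n) / 2) • normCCB (-m) (-n) (m + n)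

/-- `∑ n : c_{-m} c̃_{-n} b̃_{m+n} :`. -/
def qCCtBt : Op :=
  modeSum fun m n => (n : ℂ) • normCCtBt (-m) (-n) (m + n)

/-- `∑ (m/2 - r) c_{-m} : γ^{-s}_{-r} β^s_{m+r} :`, `r = j + 1/2`. -/
def qCGB (π : Picture) (s : Sgn) : Op :=
  modeSum fun m j => ((m : ℂ) / 2 - (j + 1 / 2)) • (c (-m) * normGB π s (-j - 1) (m + j))

/-- `± ∑ c̃_{-m} : γ^∓_{-r} β^±_{m+r} :`, `r = j + 1/2`. -/
def qCtGB (π : Picture) (s : Sgn) : Op :=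
  modeSum fun m j => (s.val : ℂ) • (ct (-m) * normGB π s (-j - 1) (m + j))

/-- `-∑ γ^-_{-r} γ^+_{-s} (4 b_{r+s} + 2 (r - s) b̃_{r+s})`, `r = i + 1/2`, `s = j + 1/2`. -/
def qGG (π : Picture) : Op :=
  modeSum fun i j => -(gam π .minus (-i - 1) * gam π .plus (-j - 1) *
    ((4 : ℂ) • b (i + j + 1) + (2 * ((i : ℂ) - j)) • bt (i + j + 1)))

/-- The BRST charge. -/
def Q (π : Picture) (k : Momentum) : Op :=
  qBose k + qFermi + qCurrent + qSuper π k .plus + qSuper π k .minus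
    + qCCB + qCCtBt + qCGB π .plus + qCGB π .minus + qCtGB π .plus + qCtGB π .minus + qGG π
    + ((vacWeight π : ℝ) : ℂ) • c 0 + (vacCharge π : ℂ) • ct 0

/-! ### The BRST complexes -/

/-- The space `F`: states annihilated by `L_0`, `J_0` and `b̃_0`. -/
def F (π : Picture) (k : Momentum) : Submodule ℂ Fock :=
  LinearMap.ker (L0 π k) ⊓ LinearMap.ker (J0 π) ⊓ LinearMap.ker (bt 0)

/-- The relative space `F_rel`: states of `F` that are also annihilated by `b_0`. -/
def Frel (π : Picture) (k : Momentum) : Submodule ℂ Fock := F π k ⊓ LinearMap.ker (b 0)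

/-- The part of ghost number `g` of a space of states. -/
def ghostPart (π : Picture) (V : Submodule ℂ Fock) (g : ℤ) : Submodule ℂ Fock :=
  V ⊓ LinearMap.ker (ghostOp π - (g : ℂ) • 1)

/-- BRST-closed states of ghost number `g`. -/
def cocycles (π : Picture) (k : Momentum) (V : Submodule ℂ Fock) (g : ℤ) : Submodule ℂ Fock :=
  ghostPart π V g ⊓ LinearMap.ker (Q π k)

/-- BRST-exact states of ghost number `g`. -/
def coboundaries (π : Picture) (k : Momentum) (V : Submodule ℂ Fock) (g : ℤ) :
    Submodule ℂ Fock :=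
  (ghostPart π V (g - 1)).map (Q π k)

/-- `Q` restricts to a differential of degree one on the graded space `V`. -/
def IsBRSTComplex (π : Picture) (k : Momentum) (V : Submodule ℂ Fock) : Prop :=
  ∀ g : ℤ, ∀ ψ ∈ ghostPart π V g, Q π k ψ ∈ ghostPart π V (g + 1) ∧ Q π k (Q π k ψ) = 0

/-- The BRST cohomology of `V` at ghost number `g`. -/
abbrev Coh (π : Picture) (k : Momentum) (V : Submodule ℂ Fock) (g : ℤ) : Type :=
  ↥(cocycles π k V g) ⧸ (coboundaries π k V g).submoduleOf (cocycles π k V g)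

/-- The states `x i` are closed of ghost number `g`, and their classes form a basis of the
cohomology at ghost number `g`. -/
def ClassesFormBasis {ι : Type} (π : Picture) (k : Momentum) (V : Submodule ℂ Fock) (g : ℤ)
    (x : ι → Fock) : Prop :=
  ∃ hx : ∀ i, x i ∈ cocycles π k V g,
    let cls : ι → Coh π k V g := fun i => Submodule.Quotient.mk ⟨x i, hx i⟩
    LinearIndependent ℂ cls ∧ Submodule.span ℂ (Set.range cls) = ⊤

/-- The `(-1,-1)` picture. -/
def picMM : Picture := ⟨-1, -1⟩

/-- The `(-1,0)` picture. -/
def picMZ : Picture := ⟨-1, 0⟩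

/-- `A_N^μ = c_1 (γ^+_{1/2})^N (γ^-_{-1/2})^N d^{-μ}_{-1/2} |-1,0,k⟩`. -/
def stateA (N : ℕ) (μ : Fin 2) : Fock :=
  (c 1 * gam picMZ .plus 0 ^ N * gam picMZ .minus (-1) ^ N * d .minus μ (-1)) vac

/-- `B_N = c_1 (γ^+_{1/2})^N (γ^-_{-1/2})^{N+1} |-1,0,k⟩`. -/
def stateB (N : ℕ) : Fock :=
  (c 1 * gam picMZ .plus 0 ^ N * gam picMZ .minus (-1) ^ (N + 1)) vac

/-- `C_N^{μν} = c_1 (γ^+_{1/2})^{N+1} (γ^-_{-1/2})^N d^{-μ}_{-1/2} d^{-ν}_{-1/2} |-1,0,k⟩`. -/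
def stateC (N : ℕ) (μ ν : Fin 2) : Fock :=
  (c 1 * gam picMZ .plus 0 ^ (N + 1) * gam picMZ .minus (-1) ^ N
    * d .minus μ (-1) * d .minus ν (-1)) vac

end

end N2String

namespace N2String

/-! ### The oscillators on occupation number states -/

/-! The conditions defining `F` and `Frel` are diagonal in the occupation basis, or are kernels of a
single fermionic annihilator, so both spaces are spans of basis states (`F_eq_spanOcc`,
`Frel_eq_spanOcc`). The decisive step is to find which states these are. In the `(-1,0)` picture
`L_0` alone gives no bound, because `γ^+_{1/2}` is a creation operator of weight `-1/2`. In `2 L_0 +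
J_0`, however, the vacuum contributes `2`, the mode `c_1` contributes `-2`, and every other
oscillator contributes a non-negative amount. Hence `c_1` must be occupied. Since `b̃_0` excludes
`c̃_0`, only the neutral modes `c_0`, `d^{-μ}_{-1/2}`, `γ^+_{1/2}`, `γ^-_{-1/2}` can accompany it
(`picMZ_low`). In the `(-1,-1)` picture `L_0` already suffices and leaves just `c_1` and `c_0 c_1`
over the vacuum (`occF_picMM`).

On such light states almost every term of the mode sums for `Q` dies: a term carries either a ghost
`c_p` or `c̃_p` with `p ≥ 1`, blocked by the occupied `c_1` or having nothing to remove, or a normal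
ordered factor that annihilates the state. What survives is `c_0 L_0 + c̃_0 J_0` and, in the
`(-1,0)` picture, `-4 γ^+_{1/2} γ^-_{-1/2} b_0` (`Q_picMZ_single`, `Q_picMM_single`). The first two
terms vanish on `F`.

So in the `(-1,0)` picture at `k = 0`, `Q` trades `c_0` for a pair `γ^+_{1/2} γ^-_{-1/2}`. It is
zero on `Frel`; on `F` the closed states are those without `c_0`, and the exact ones are the closed
states containing at least one quantum of each `γ`. With `α`, `β` quanta of the two ghosts and a set
`T` of matter fermions, neutrality reads `β + |T| = α + 1`. The values `|T| = 1, 0, 2` give the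
families `A`, `B`, `C`, and only `N = 0` survives absolutely. In the `(-1,-1)` picture `Q` vanishes
on `F`, independently of the null momentum. -/

theorem onBasis_single (f : Occ → Fock) (e : Occ) (z : ℂ) :
    onBasis f (Finsupp.single e z) = z • f e :=
  Finsupp.linearCombination_single ℂ z e

theorem createF_single (i : FermiMode) (S : Finset FermiMode) (n : BoseMode →₀ ℕ) (z : ℂ) :
    createF i (Finsupp.single (S, n) z) =
      Finsupp.single (insert i S, n) (if i ∈ S then 0 else z * fermiSign S i) := by
  rw [createF, onBasis_single]
  split_ifs <;> simp

theorem annihF_single (i : FermiMode) (S : Finset FermiMode) (n : BoseMode →₀ ℕ) (z : ℂ) :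
    annihF i (Finsupp.single (S, n) z) =
      Finsupp.single (S.erase i, n) (if i ∈ S then z * fermiSign S i else 0) := by
  rw [annihF, onBasis_single]
  split_ifs <;> simp

theorem createB_single (i : BoseMode) (S : Finset FermiMode) (n : BoseMode →₀ ℕ) (z : ℂ) :
    createB i (Finsupp.single (S, n) z) = Finsupp.single (S, n + Finsupp.single i 1) z := by
  rw [createB, onBasis_single]
  simp

theorem annihB_single (i : BoseMode) (S : Finset FermiMode) (n : BoseMode →₀ ℕ) (z : ℂ) :
    annihB i (Finsupp.single (S, n) z) =
      Finsupp.single (S, n - Finsupp.single i 1) (z * (n i : ℂ)) := by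
  rw [annihB, onBasis_single]
  simp

/-! ### Evaluating mode sums on a basis state -/

theorem modeSum_single (f : ℤ → ℤ → Op) (e : Occ) :
    modeSum f (Finsupp.single e 1) = ∑ᶠ p : ℤ × ℤ, f p.1 p.2 (Finsupp.single e 1) := by
  rw [modeSum, onBasis_single, one_smul]

theorem modeSum_single_eq_zero {f : ℤ → ℤ → Op} {e : Occ}
    (h : ∀ m n, f m n (Finsupp.single e 1) = 0) : modeSum f (Finsupp.single e 1) = 0 := by
  rw [modeSum_single]
  exact finsum_eq_zero_of_forall_eq_zero fun p => h p.1 p.2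

/-- A `finsum` with infinitely many non-zero terms has the default value `0`. Exhibiting a single
possible non-zero term settles finiteness and value together. -/
theorem modeSum_single_eq {f : ℤ → ℤ → Op} {e : Occ} (m₀ n₀ : ℤ)
    (h : ∀ m n, ¬(m = m₀ ∧ n = n₀) → f m n (Finsupp.single e 1) = 0) :
    modeSum f (Finsupp.single e 1) = f m₀ n₀ (Finsupp.single e 1) := by
  rw [modeSum_single, finsum_eq_single _ (m₀, n₀)]
  rintro ⟨m, n⟩ hp
  exact h m n fun hh => hp (by rw [hh.1, hh.2])

theorem modeSum_single_eq_add {f : ℤ → ℤ → Op} {e : Occ} (p q : ℤ × ℤ) (hpq : p ≠ q)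
    (h : ∀ m n, (m, n) ≠ p → (m, n) ≠ q → f m n (Finsupp.single e 1) = 0) :
    modeSum f (Finsupp.single e 1) =
      f p.1 p.2 (Finsupp.single e 1) + f q.1 q.2 (Finsupp.single e 1) := by
  rw [modeSum_single, finsum_eq_sum_of_support_subset (s := {p, q}), Finset.sum_pair hpq]
  rintro ⟨m, n⟩ hx
  by_contra hc
  simp only [Finset.coe_insert, Finset.coe_singleton, Set.mem_insert_iff,
    Set.mem_singleton_iff, not_or] at hc
  exact hx (h m n hc.1 hc.2)

theorem fermiSign_mul_self (S : Finset FermiMode) (i : FermiMode) :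
    fermiSign S i * fermiSign S i = 1 := by
  rw [fermiSign, ← mul_pow]; simp

theorem fermiSign_erase_self (S : Finset FermiMode) (i : FermiMode) :
    fermiSign (S.erase i) i = fermiSign S i := by
  unfold fermiSign
  congr 2
  ext x
  simp only [Finset.mem_filter, Finset.mem_erase]
  exact ⟨fun h => ⟨h.1.2, h.2⟩, fun h => ⟨⟨h.2.ne, h.1⟩, h.2⟩⟩

theorem createF_annihF_single (i : FermiMode) (S : Finset FermiMode) (n : BoseMode →₀ ℕ)
    (z : ℂ) : createF i (annihF i (Finsupp.single (S, n) z)) =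
      Finsupp.single (S, n) (if i ∈ S then z else 0) := by
  rw [annihF_single, createF_single]
  by_cases h : i ∈ S
  · simp [h, fermiSign_erase_self, mul_assoc, fermiSign_mul_self]
  · simp [h]

theorem createB_annihB_single (i : BoseMode) (S : Finset FermiMode) (n : BoseMode →₀ ℕ)
    (z : ℂ) : createB i (annihB i (Finsupp.single (S, n) z)) =
      Finsupp.single (S, n) (z * (n i : ℂ)) := by
  rw [annihB_single, createB_single]
  -- On an empty mode the truncated subtraction followed by the addition would alter the occupation;
  -- the coefficient `n i = 0` makes this harmless.
  rcases Nat.eq_zero_or_pos (n i) with h | h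
  · simp [h]
  · rw [tsub_add_cancel_of_le (Finsupp.single_le_iff.2 h)]

/-- The arguments below that a ghost mode kills a state only look at the ghost occupations. It is
therefore enough to know that matter modes send a basis state to a multiple of another with the same
ghosts, whatever the multiple. -/
theorem exists_d_single (s : Sgn) (μ : Fin 2) (j : ℤ) (S : Finset FermiMode)
    (n : BoseMode →₀ ℕ) (z : ℂ) : ∃ S' z', d s μ j (Finsupp.single (S, n) z) =
      Finsupp.single (S', n) z' ∧ (∀ q, .bc q ∈ S' ↔ .bc q ∈ S) ∧
        ∀ q, .bct q ∈ S' ↔ .bct q ∈ S := by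
  rcases j with j | j
  · refine ⟨S.erase (.psi s.opp μ j), ((2 * eta μ : ℝ) : ℂ) •
      (if .psi s.opp μ j ∈ S then z * fermiSign S (.psi s.opp μ j) else 0), ?_, by simp, by simp⟩
    rw [d, LinearMap.smul_apply, annihF_single, Finsupp.smul_single]
  · exact ⟨insert (.psi s μ j) S, if .psi s μ j ∈ S then 0 else z * fermiSign S (.psi s μ j),
      by rw [d, createF_single], by simp, by simp⟩

theorem exists_normDD_single (μ : Fin 2) (i j : ℤ) (S : Finset FermiMode)
    (n : BoseMode →₀ ℕ) (z : ℂ) : ∃ S' z', normDD μ i j (Finsupp.single (S, n) z) =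
      Finsupp.single (S', n) z' ∧ (∀ q, .bc q ∈ S' ↔ .bc q ∈ S) ∧
        ∀ q, .bct q ∈ S' ↔ .bct q ∈ S := by
  rw [normDD]
  split_ifs
  · obtain ⟨S₁, z₁, e₁, h₁, k₁⟩ := exists_d_single .plus μ i S n z
    obtain ⟨S₂, z₂, e₂, h₂, k₂⟩ := exists_d_single .minus μ j S₁ n z₁
    refine ⟨S₂, -z₂, ?_, fun q => (h₂ q).trans (h₁ q), fun q => (k₂ q).trans (k₁ q)⟩
    rw [LinearMap.neg_apply, Module.End.mul_apply, e₁, e₂, Finsupp.single_neg]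
  · obtain ⟨S₁, z₁, e₁, h₁, k₁⟩ := exists_d_single .minus μ j S n z
    obtain ⟨S₂, z₂, e₂, h₂, k₂⟩ := exists_d_single .plus μ i S₁ n z₁
    refine ⟨S₂, z₂, ?_, fun q => (h₂ q).trans (h₁ q), fun q => (k₂ q).trans (k₁ q)⟩
    rw [Module.End.mul_apply, e₁, e₂]

theorem exists_a_single (k : Momentum) (s : Sgn) (μ : Fin 2) (m : ℤ) (S : Finset FermiMode)
    (n : BoseMode →₀ ℕ) (z : ℂ) : ∃ n' z', a k s μ m (Finsupp.single (S, n) z) =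
      Finsupp.single (S, n') z' ∧ ∀ t j, n' (.ghost t j) = n (.ghost t j) := by
  rcases m with (_ | m) | m
  · refine ⟨n, k.comp s μ • z, ?_, fun _ _ => rfl⟩
    rw [a, LinearMap.smul_apply, Module.End.one_apply, Finsupp.smul_single]
  · refine ⟨n - Finsupp.single (.alpha s.opp μ m) 1, ((2 * (m + 1 : ℕ) * eta μ : ℝ) : ℂ) •
      (z * (n (.alpha s.opp μ m) : ℂ)), ?_, by simp⟩
    rw [a, LinearMap.smul_apply, annihB_single, Finsupp.smul_single]
  · exact ⟨n + Finsupp.single (.alpha s μ m) 1, z, by rw [a, createB_single], by simp⟩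

theorem exists_normAA_single (k : Momentum) (μ : Fin 2) (i j : ℤ) (S : Finset FermiMode)
    (n : BoseMode →₀ ℕ) (z : ℂ) : ∃ n' z', normAA k μ i j (Finsupp.single (S, n) z) =
      Finsupp.single (S, n') z' := by
  rw [normAA]
  split_ifs
  · obtain ⟨n₁, z₁, e₁, -⟩ := exists_a_single k .plus μ i S n z
    obtain ⟨n₂, z₂, e₂, -⟩ := exists_a_single k .minus μ j S n₁ z₁
    exact ⟨n₂, z₂, by rw [Module.End.mul_apply, e₁, e₂]⟩
  · obtain ⟨n₁, z₁, e₁, -⟩ := exists_a_single k .minus μ j S n z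
    obtain ⟨n₂, z₂, e₂, -⟩ := exists_a_single k .plus μ i S n₁ z₁
    exact ⟨n₂, z₂, by rw [Module.End.mul_apply, e₁, e₂]⟩

theorem exists_gam_single (π : Picture) (s : Sgn) (j : ℤ) (S : Finset FermiMode)
    (n : BoseMode →₀ ℕ) (z : ℂ) : ∃ n' z', gam π s j (Finsupp.single (S, n) z) =
      Finsupp.single (S, n') z' := by
  rw [gam]
  split_ifs
  · exact ⟨_, _, createB_single ..⟩
  · exact ⟨_, _, annihB_single ..⟩

theorem exists_bet_single (π : Picture) (s : Sgn) (j : ℤ) (S : Finset FermiMode)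
    (n : BoseMode →₀ ℕ) (z : ℂ) : ∃ n' z', bet π s j (Finsupp.single (S, n) z) =
      Finsupp.single (S, n') z' := by
  rw [bet]
  split_ifs
  · exact ⟨_, _, by rw [LinearMap.neg_apply, annihB_single, ← Finsupp.single_neg]⟩
  · exact ⟨_, _, createB_single ..⟩

theorem exists_normGB_single (π : Picture) (s : Sgn) (i j : ℤ) (S : Finset FermiMode)
    (n : BoseMode →₀ ℕ) (z : ℂ) : ∃ n' z', normGB π s i j (Finsupp.single (S, n) z) =
      Finsupp.single (S, n') z' := by
  rw [normGB]
  split_ifs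
  · obtain ⟨n₁, z₁, e₁⟩ := exists_bet_single π s j S n z
    obtain ⟨n₂, z₂, e₂⟩ := exists_gam_single π s.opp i S n₁ z₁
    exact ⟨n₂, z₂, by rw [Module.End.mul_apply, e₁, e₂]⟩
  · obtain ⟨n₁, z₁, e₁⟩ := exists_gam_single π s.opp i S n z
    obtain ⟨n₂, z₂, e₂⟩ := exists_bet_single π s j S n₁ z₁
    exact ⟨n₂, z₂, by rw [Module.End.mul_apply, e₁, e₂]⟩

/-! ### States over `c_1` with only the lightest oscillators excited -/

/-- Among the fermionic oscillators `c_1` is occupied, and at most `c_0` and `d^{-μ}_{-1/2}`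
besides it. -/
structure LowFermi (S : Finset FermiMode) : Prop where
  bc_one : .bc 1 ∈ S
  bc_le : ∀ q, .bc q ∈ S → q = 0 ∨ q = 1
  bct : ∀ q, .bct q ∉ S
  psi_plus : ∀ μ n, .psi .plus μ n ∉ S
  psi_minus : ∀ μ n, .psi .minus μ n ∈ S → n = 0

/-- Among the bosonic oscillators at most `γ^+_{1/2}` and `γ^-_{-1/2}` are occupied. -/
structure LowBose (n : BoseMode →₀ ℕ) : Prop where
  alpha : ∀ s μ m, n (.alpha s μ m) = 0
  plus : ∀ j, j ≠ 0 → n (.ghost .plus j) = 0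
  minus : ∀ j, j ≠ -1 → n (.ghost .minus j) = 0

/-! ### Vanishing from the occupied `c_1` -/

/-- The Pauli principle for `p = 1`; for `p ≥ 2` the mode `c_p` removes a `b_{-p}` that is not
there. -/
theorem c_single_eq_zero {S : Finset FermiMode} {n : BoseMode →₀ ℕ} {z : ℂ}
    (h1 : .bc 1 ∈ S) (h2 : ∀ q, 2 ≤ q → .bc q ∉ S) {p : ℤ} (hp : 1 ≤ p) :
    c p (Finsupp.single (S, n) z) = 0 := by
  rw [c]
  split_ifs with h
  · obtain rfl : p = 1 := by omega
    simp [createF_single, h1]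
  · simp [annihF_single, h2 p (by omega)]

theorem ct_single_eq_zero {S : Finset FermiMode} {n : BoseMode →₀ ℕ} {z : ℂ}
    (h : ∀ q, .bct q ∉ S) {p : ℤ} (hp : 1 ≤ p) : ct p (Finsupp.single (S, n) z) = 0 := by
  rw [ct, if_neg (by omega), annihF_single, if_neg (h p), Finsupp.single_zero]

theorem LowFermi.not_mem {S : Finset FermiMode} (hS : LowFermi S) (q : ℤ) (hq : 2 ≤ q) :
    .bc q ∉ S := fun h => by rcases hS.bc_le q h with h | h <;> omega

/-- Disposes of every term `c_{-n} X_n` with `n < 0`, without computing `X_n`: it suffices that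
`X_n` preserves the `bc` occupations. -/
theorem LowFermi.c_mul_apply_eq_zero {S : Finset FermiMode} (hS : LowFermi S) {X : Op}
    {n : BoseMode →₀ ℕ}
    (hX : ∃ S' n' z', X (Finsupp.single (S, n) 1) = Finsupp.single (S', n') z' ∧
      ∀ q, .bc q ∈ S' ↔ .bc q ∈ S) {p : ℤ} (hp : 1 ≤ p) :
    (c p * X) (Finsupp.single (S, n) 1) = 0 := by
  obtain ⟨S', n', z', e, h⟩ := hX
  rw [Module.End.mul_apply, e]
  exact c_single_eq_zero ((h 1).2 hS.bc_one) (fun q hq hq' => hS.not_mem q hq ((h q).1 hq')) hp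

theorem LowFermi.ct_mul_apply_eq_zero {S : Finset FermiMode} (hS : LowFermi S) {X : Op}
    {n : BoseMode →₀ ℕ}
    (hX : ∃ S' n' z', X (Finsupp.single (S, n) 1) = Finsupp.single (S', n') z' ∧
      ∀ q, .bct q ∈ S' ↔ .bct q ∈ S) {p : ℤ} (hp : 1 ≤ p) :
    (ct p * X) (Finsupp.single (S, n) 1) = 0 := by
  obtain ⟨S', n', z', e, h⟩ := hX
  rw [Module.End.mul_apply, e]
  exact ct_single_eq_zero (fun q hq => hS.bct q ((h q).1 hq)) hp

/-! ### Matter fermion terms of the charge -/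

/-- The number of occupied oscillators `d^{-μ}_{-1/2}`. -/
noncomputable def numPsi (S : Finset FermiMode) : ℂ :=
  ∑ μ : Fin 2, if FermiMode.psi .minus μ 0 ∈ S then 1 else 0

/-- For non-negative total mode number the factor acting first is an annihilator. The only matter
fermions available to it are `d^{-μ}_{-1/2}`, which leaves just the number operator at `i = 0`, `j =
-1`. -/
theorem normDD_single_eq_zero {S : Finset FermiMode} (hS : LowFermi S) (n : BoseMode →₀ ℕ)
    (μ : Fin 2) {i j : ℤ} (hij : 0 ≤ i + j + 1) (h : ¬(i = 0 ∧ j = -1)) :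
    normDD μ i j (Finsupp.single (S, n) 1) = 0 := by
  rw [normDD]
  split_ifs with hj
  · lift i to ℕ using by omega
    have hi : FermiMode.psi .minus μ i ∉ S := fun hm => by
      have := hS.psi_minus μ i hm
      omega
    have : d .plus μ (i : ℤ) (Finsupp.single (S, n) 1) = 0 := by
      show (((2 * eta μ : ℝ) : ℂ) • annihF (.psi .minus μ i)) _ = 0
      rw [LinearMap.smul_apply, annihF_single, if_neg hi]
      simp
    rw [LinearMap.neg_apply, Module.End.mul_apply, this, map_zero, neg_zero]
  · lift j to ℕ using by omega
    have : d .minus μ (j : ℤ) (Finsupp.single (S, n) 1) = 0 := by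
      show (((2 * eta μ : ℝ) : ℂ) • annihF (.psi .plus μ j)) _ = 0
      rw [LinearMap.smul_apply, annihF_single, if_neg (hS.psi_plus μ j)]
      simp
    rw [Module.End.mul_apply, this, map_zero]

theorem eta_mul_self (μ : Fin 2) : ((eta μ : ℝ) : ℂ) * (eta μ : ℝ) = 1 := by
  unfold eta; split_ifs <;> simp

theorem normDD_zero_neg_one_single (S : Finset FermiMode) (n : BoseMode →₀ ℕ) (μ : Fin 2) :
    normDD μ 0 (-1) (Finsupp.single (S, n) 1) =
      (-2 * (eta μ : ℂ) * (if FermiMode.psi .minus μ 0 ∈ S then 1 else 0)) •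
        Finsupp.single (S, n) 1 := by
  rw [normDD, if_pos (by omega), LinearMap.neg_apply, Module.End.mul_apply]
  show -(createF (.psi .minus μ 0) ((((2 * eta μ : ℝ) : ℂ) • annihF (.psi .minus μ 0)) _)) = _
  rw [LinearMap.smul_apply, map_smul, createF_annihF_single]
  split_ifs <;> simp

/-- Each `d^{-μ}_{-1/2}` contributes its weight `1/2`: the factor `-η/4` of the sum meets `-2η` from
the number operator, and `η² = 1`. -/
theorem qFermi_single {S : Finset FermiMode} (hS : LowFermi S) (n : BoseMode →₀ ℕ) :
    qFermi (Finsupp.single (S, n) 1) = (numPsi S / 2) • c 0 (Finsupp.single (S, n) 1) := by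
  rw [qFermi, modeSum_single_eq 0 (-1)]
  · simp only [LinearMap.sum_apply, LinearMap.smul_apply, Module.End.mul_apply,
      normDD_zero_neg_one_single, map_smul, smul_smul, ← Finset.sum_smul, numPsi,
      Finset.sum_div]
    congr 1
    refine Finset.sum_congr rfl fun μ _ => ?_
    push_cast
    linear_combination ((if FermiMode.psi .minus μ 0 ∈ S then 1 else 0 : ℂ) / 2) * eta_mul_self μ
  · intro i j h
    rw [LinearMap.sum_apply]
    refine Finset.sum_eq_zero fun μ _ => ?_
    rw [LinearMap.smul_apply]
    rcases le_or_gt 0 (i + j + 1) with hp | hp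
    · rw [Module.End.mul_apply, normDD_single_eq_zero hS n μ hp h, map_zero, smul_zero]
    · obtain ⟨S', z', e, h1, -⟩ := exists_normDD_single μ i j S n 1
      rw [hS.c_mul_apply_eq_zero ⟨S', n, z', e, h1⟩ (by omega), smul_zero]

theorem qCurrent_single {S : Finset FermiMode} (hS : LowFermi S) (n : BoseMode →₀ ℕ) :
    qCurrent (Finsupp.single (S, n) 1) = (-numPsi S) • ct 0 (Finsupp.single (S, n) 1) := by
  rw [qCurrent, modeSum_single_eq 0 (-1)]
  · simp only [LinearMap.sum_apply, LinearMap.smul_apply, Module.End.mul_apply,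
      normDD_zero_neg_one_single, map_smul, smul_smul, ← Finset.sum_smul, numPsi,
      ← Finset.sum_neg_distrib]
    congr 1
    refine Finset.sum_congr rfl fun μ _ => ?_
    push_cast
    linear_combination (-(if FermiMode.psi .minus μ 0 ∈ S then 1 else 0 : ℂ)) * eta_mul_self μ
  · intro i j h
    rw [LinearMap.sum_apply]
    refine Finset.sum_eq_zero fun μ _ => ?_
    rw [LinearMap.smul_apply]
    rcases le_or_gt 0 (i + j + 1) with hp | hp
    · rw [Module.End.mul_apply, normDD_single_eq_zero hS n μ hp h, map_zero, smul_zero]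
    · obtain ⟨S', z', e, -, h1⟩ := exists_normDD_single μ i j S n 1
      rw [hS.ct_mul_apply_eq_zero ⟨S', n, z', e, h1⟩ (by omega), smul_zero]

/-! ### Reparametrisation and `U(1)` ghost terms -/

theorem b_single_eq_zero {S : Finset FermiMode} (hS : LowFermi S) (n : BoseMode →₀ ℕ) {p : ℤ}
    (hp : 1 ≤ p) : b p (Finsupp.single (S, n) 1) = 0 := by
  have : FermiMode.bc (-p) ∉ S := fun h => by rcases hS.bc_le _ h with h | h <;> omega
  rw [b, if_neg (by omega), annihF_single, if_neg this, Finsupp.single_zero]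

theorem bt_single_eq_zero {S : Finset FermiMode} (hS : LowFermi S) (n : BoseMode →₀ ℕ) {p : ℤ}
    (hp : 0 ≤ p) : bt p (Finsupp.single (S, n) 1) = 0 := by
  rw [bt, if_neg (by omega), annihF_single, if_neg (hS.bct _), Finsupp.single_zero]

theorem exists_c_single (p : ℤ) (S : Finset FermiMode) (n : BoseMode →₀ ℕ) (z : ℂ) :
    ∃ S' z', c p (Finsupp.single (S, n) z) = Finsupp.single (S', n) z' ∧
      (∀ q, q ≠ p → (.bc q ∈ S' ↔ .bc q ∈ S)) ∧ ∀ q, .bct q ∈ S' ↔ .bct q ∈ S := by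
  rw [c]
  split_ifs
  · exact ⟨_, _, createF_single .., by simp +contextual, by simp⟩
  · exact ⟨_, _, annihF_single .., by simp +contextual, by simp⟩

theorem exists_ct_single (p : ℤ) (S : Finset FermiMode) (n : BoseMode →₀ ℕ) (z : ℂ) :
    ∃ S' z', ct p (Finsupp.single (S, n) z) = Finsupp.single (S', n) z' ∧
      ∀ q, .bc q ∈ S' ↔ .bc q ∈ S := by
  rw [ct]
  split_ifs
  · exact ⟨_, _, createF_single .., by simp⟩
  · exact ⟨_, _, annihF_single .., by simp⟩

/-- `c_l c_m` annihilates a state on which the annihilation operators among `c_l`, `c_m` have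
nothing to remove. -/
theorem c_c_single_eq_zero {S : Finset FermiMode} (hS : ∀ q, 2 ≤ q → .bc q ∉ S)
    (n : BoseMode →₀ ℕ) (z : ℂ) {l m : ℤ} (h : 2 ≤ l ∨ 2 ≤ m) :
    c l (c m (Finsupp.single (S, n) z)) = 0 := by
  rcases le_or_gt 2 m with hm | hm
  · have : c m (Finsupp.single (S, n) z) = 0 := by
      rw [c, if_neg (by omega), annihF_single, if_neg (hS m hm), Finsupp.single_zero]
    rw [this, map_zero]
  · obtain ⟨S', z', e, h1, -⟩ := exists_c_single m S n z
    have hl : 2 ≤ l := by omega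
    rw [e, c, if_neg (by omega), annihF_single, if_neg, Finsupp.single_zero]
    rw [h1 l (by omega)]
    exact hS l hl

theorem LowFermi.erase_bc_zero {S : Finset FermiMode} (hS : LowFermi S) :
    LowFermi (S.erase (.bc 0)) where
  bc_one := by simpa using hS.bc_one
  bc_le q h := hS.bc_le q (Finset.mem_of_mem_erase h)
  bct q h := hS.bct q (Finset.mem_of_mem_erase h)
  psi_plus μ n h := hS.psi_plus μ n (Finset.mem_of_mem_erase h)
  psi_minus μ n h := hS.psi_minus μ n (Finset.mem_of_mem_erase h)

theorem LowFermi.c_c_single_eq_zero {S : Finset FermiMode} (hS : LowFermi S)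
    (n : BoseMode →₀ ℕ) (z : ℂ) {l m : ℤ} (h : 1 ≤ l ∨ 1 ≤ m) :
    c l (c m (Finsupp.single (S, n) z)) = 0 := by
  rcases le_or_gt 1 m with hm | hm
  · rw [c_single_eq_zero hS.bc_one hS.not_mem hm, map_zero]
  · obtain ⟨S', z', e, h1, -⟩ := exists_c_single m S n z
    rw [e]
    refine c_single_eq_zero ((h1 1 (by omega)).2 hS.bc_one) (fun q hq hq' => ?_)
      (by omega : 1 ≤ l)
    exact hS.not_mem q hq ((h1 q (by omega)).1 hq')

theorem fermiSign_eq_one {S : Finset FermiMode} {i : FermiMode} (h : ∀ j ∈ S, ¬ j < i) :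
    fermiSign S i = 1 := by
  rw [fermiSign, Finset.filter_false_of_mem h]; simp

theorem bc_zero_lt_bc_one : FermiMode.bc 0 < .bc 1 := by
  show toLex (0, (0 : ℤ)) < toLex (0, (1 : ℤ))
  simp [Prod.Lex.toLex_lt_toLex]

theorem bc_lt_psi_minus (q : ℤ) (μ : Fin 2) (n : ℕ) : FermiMode.bc q < .psi .minus μ n := by
  show toLex (0, q) < toLex (4 + μ.val, (n : ℤ))
  simp [Prod.Lex.toLex_lt_toLex]

theorem LowFermi.eq_or_lt {S : Finset FermiMode} (hS : LowFermi S) {i : FermiMode} (hi : i ∈ S) :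
    i = .bc 0 ∨ i = .bc 1 ∨ .bc 1 < i := by
  rcases i with q | q | ⟨_ | _, μ, n⟩
  · rcases hS.bc_le q hi with rfl | rfl <;> simp
  · exact (hS.bct q hi).elim
  · exact (hS.psi_plus μ n hi).elim
  · exact .inr (.inr (bc_lt_psi_minus _ _ _))

theorem LowFermi.fermiSign_bc_zero {S : Finset FermiMode} (hS : LowFermi S) :
    fermiSign S (.bc 0) = 1 := by
  refine fermiSign_eq_one fun j hj => ?_
  rcases hS.eq_or_lt hj with rfl | rfl | h
  · exact lt_irrefl _
  · exact bc_zero_lt_bc_one.le.not_gt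
  · exact (bc_zero_lt_bc_one.trans h).le.not_gt

/-- This is `c_1 c_0 = -c_0 c_1` together with `c_1 b_{-1} = 1` on an occupied `c_1`. The sign
arises because `c_0` precedes `c_1` in the ordering, so inserting it flips the sign with which `c_1`
is created. -/
theorem c_one_c_zero_b_neg_one_single {S : Finset FermiMode} (hS : LowFermi S)
    (n : BoseMode →₀ ℕ) : c 1 (c 0 (b (-1) (Finsupp.single (S, n) 1))) =
      -c 0 (Finsupp.single (S, n) 1) := by
  have h1 : fermiSign (insert (.bc 0) (S.erase (.bc 1))) (.bc 1) =
      if .bc 0 ∈ S then fermiSign S (.bc 1) else -fermiSign S (.bc 1) := by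
    -- Only `c_0` can precede `c_1` among the modes allowed here, so the sign at `c_1` depends on
    -- `c_0` alone.
    have key : ∀ T : Finset FermiMode, (∀ j ∈ T, j = .bc 0 ∨ j = .bc 1 ∨ .bc 1 < j) →
        fermiSign T (.bc 1) = if .bc 0 ∈ T then -1 else 1 := by
      intro T hT
      have : T.filter (· < .bc 1) = if .bc 0 ∈ T then {.bc 0} else ∅ := by
        ext x
        simp only [Finset.mem_filter]
        constructor
        · rintro ⟨hx, hlt⟩
          rcases hT x hx with rfl | rfl | h
          · simp [hx]
          · exact (lt_irrefl _ hlt).elim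
          · exact (lt_asymm h hlt).elim
        · split_ifs with h0
          · rintro hx
            rw [Finset.mem_singleton] at hx
            subst hx
            exact ⟨h0, bc_zero_lt_bc_one⟩
          · simp
      rw [fermiSign, this]
      split_ifs <;> simp
    rw [key S fun j hj => hS.eq_or_lt hj, key]
    · simp only [Finset.mem_insert_self, if_true]
      split_ifs <;> simp
    · intro j hj
      rcases Finset.mem_insert.1 hj with rfl | hj
      · simp
      · exact hS.eq_or_lt (Finset.mem_of_mem_erase hj)
  have h0 : fermiSign (S.erase (.bc 1)) (.bc 0) = 1 := by
    refine fermiSign_eq_one fun j hj => ?_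
    rcases hS.eq_or_lt (Finset.mem_of_mem_erase hj) with rfl | rfl | h
    · exact lt_irrefl _
    · exact bc_zero_lt_bc_one.le.not_gt
    · exact (bc_zero_lt_bc_one.trans h).le.not_gt
  rw [b, if_neg (by omega), c, if_pos le_rfl, c, if_pos (by omega)]
  norm_num only
  rw [annihF_single, createF_single, createF_single, createF_single, h1, h0,
    hS.fermiSign_bc_zero, if_pos hS.bc_one]
  by_cases h : .bc 0 ∈ S
  · simp [h, hS.bc_one]
  · simp only [Finset.mem_erase, h, Finset.mem_insert]
    simp [fermiSign_mul_self, Finset.insert_comm (FermiMode.bc 1),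
      Finset.insert_erase hS.bc_one, Finsupp.single_neg]

theorem c_zero_c_one_b_neg_one_single {S : Finset FermiMode} (hS : LowFermi S)
    (n : BoseMode →₀ ℕ) : c 0 (c 1 (b (-1) (Finsupp.single (S, n) 1))) =
      c 0 (Finsupp.single (S, n) 1) := by
  have : c 1 (b (-1) (Finsupp.single (S, n) 1)) = Finsupp.single (S, n) 1 := by
    rw [b, if_neg (by omega), c, if_pos le_rfl]
    norm_num only
    rw [createF_annihF_single, if_pos hS.bc_one]
  rw [this]

/-- The weight `-1` of the occupied `c_1`. The two orderings of the pair `c_0`, `c_1` each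
contribute `-1/2`. -/
theorem qCCB_single {S : Finset FermiMode} (hS : LowFermi S) (n : BoseMode →₀ ℕ) :
    qCCB (Finsupp.single (S, n) 1) = -c 0 (Finsupp.single (S, n) 1) := by
  rw [qCCB, modeSum_single_eq_add (-1, 0) (0, -1) (by simp)]
  · simp only [LinearMap.smul_apply, normCCB]
    norm_num only
    simp only [if_false, Module.End.mul_apply, c_one_c_zero_b_neg_one_single hS,
      c_zero_c_one_b_neg_one_single hS]
    module
  · intro l m h1 h2
    rw [LinearMap.smul_apply, normCCB]
    split_ifs with hp
    · rw [Module.End.mul_apply, Module.End.mul_apply]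
      rw [hS.c_c_single_eq_zero n 1 (by omega), map_zero, smul_zero]
    · rw [Module.End.mul_apply, Module.End.mul_apply]
      rcases le_or_gt 1 (l + m) with hq | hq
      · rw [b_single_eq_zero hS n hq, map_zero, map_zero, smul_zero]
      -- Equal indices carry the coefficient `l - m = 0`. Otherwise, for `l + m = 0` one ghost has
      -- index at least `1` while `c_1` stays occupied. For `l + m = -1`, outside the two listed
      -- pairs, one ghost has index at least `2`.
      · by_cases hlm : l = m
        · rw [hlm]; simp
        · simp only [ne_eq, Prod.mk.injEq] at h1 h2
          rw [b, if_neg hp, annihF_single]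
          obtain h0 | h0 : l + m = 0 ∨ l + m = -1 := by omega
          · rw [h0, neg_zero, hS.erase_bc_zero.c_c_single_eq_zero n _ (by omega), smul_zero]
          · rw [c_c_single_eq_zero _ n _ (by omega), smul_zero]
            exact fun q hq hq' => hS.not_mem q hq (Finset.mem_of_mem_erase hq')

theorem qCCtBt_single {S : Finset FermiMode} (hS : LowFermi S) (n : BoseMode →₀ ℕ) :
    qCCtBt (Finsupp.single (S, n) 1) = 0 := by
  refine modeSum_single_eq_zero fun l m => ?_
  rw [LinearMap.smul_apply, normCCtBt]
  split_ifs with hp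
  · rw [mul_assoc, Module.End.mul_apply]
    rcases le_or_gt 1 (-m) with hm | hm
    · rw [Module.End.mul_apply, ct_single_eq_zero hS.bct hm, map_zero, map_zero, smul_zero]
    · obtain ⟨S', z', e, h1⟩ := exists_ct_single (-m) S n 1
      rw [hS.c_mul_apply_eq_zero ⟨S', n, z', e, h1⟩ (by omega), map_zero, smul_zero]
  · rw [Module.End.mul_apply, bt_single_eq_zero hS n (by omega), map_zero, smul_zero]

/-! ### Spinor ghost number terms -/

/-- `: γ^{-s} β^s :` of total mode number `m ≥ 0` annihilates states with excitations of the top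
creation mode of `γ^{-s}` only, except for the number operator of that mode. -/
theorem normGB_single_eq_zero (π : Picture) (s : Sgn) {S : Finset FermiMode}
    (n : BoseMode →₀ ℕ) (hn : ∀ j, j ≠ π.level s.opp → n (.ghost s.opp j) = 0) {i m : ℤ}
    (hm : 0 ≤ m) (h : ¬(m = 0 ∧ i = π.level s.opp)) :
    normGB π s i (m - i - 1) (Finsupp.single (S, n) 1) = 0 := by
  have e : -(m - i - 1) - 1 = i - m := by ring
  rw [normGB, bet, e]
  split_ifs with hc
  · rw [Module.End.mul_apply, LinearMap.neg_apply, annihB_single, map_neg]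
    by_cases hi : i - m = π.level s.opp
    · rw [gam, if_neg (by unfold gammaCreates; omega), annihB_single]
      have : (n - Finsupp.single (BoseMode.ghost s.opp (i - m)) 1 : BoseMode →₀ ℕ) (.ghost s.opp i) = 0 := by
        rw [Finsupp.tsub_apply, hn i (by omega), Nat.zero_sub]
      rw [this]
      simp
    · rw [hn _ hi]
      simp
  · have : gam π s.opp i (Finsupp.single (S, n) 1) = 0 := by
      unfold gammaCreates at hc
      rw [gam, if_neg (by unfold gammaCreates; omega), annihB_single, hn i (by omega)]
      simp
    rw [Module.End.mul_apply, this, map_zero]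

theorem normGB_level_single (π : Picture) (s : Sgn) (S : Finset FermiMode)
    (n : BoseMode →₀ ℕ) : normGB π s (π.level s.opp) (-π.level s.opp - 1)
      (Finsupp.single (S, n) 1) =
        (-(n (.ghost s.opp (π.level s.opp)) : ℂ)) • Finsupp.single (S, n) 1 := by
  have e : -(-π.level s.opp - 1) - 1 = π.level s.opp := by ring
  have hc : gammaCreates π s.opp (π.level s.opp) := le_rfl
  rw [normGB, bet, e, if_pos hc, if_pos hc, gam, if_pos hc, Module.End.mul_apply,
    LinearMap.neg_apply, map_neg, createB_annihB_single]
  simp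

/-- Each quantum of the top creation mode `γ_r`, `r = level + 1/2`, contributes its weight `-r`;
every other normal ordered term either kills the state or comes with a `c_p`, `p ≥ 1`. -/
theorem qCGB_single (π : Picture) (s : Sgn) {S : Finset FermiMode} (hS : LowFermi S)
    (n : BoseMode →₀ ℕ) (hn : ∀ j, j ≠ π.level s.opp → n (.ghost s.opp j) = 0) :
    qCGB π s (Finsupp.single (S, n) 1) =
      (-((π.level s.opp : ℂ) + 1 / 2) * n (.ghost s.opp (π.level s.opp))) •
        c 0 (Finsupp.single (S, n) 1) := by
  rw [qCGB, modeSum_single_eq 0 (-π.level s.opp - 1)]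
  · have e : -(-π.level s.opp - 1) - 1 = π.level s.opp := by ring
    rw [LinearMap.smul_apply, e, zero_add, Module.End.mul_apply, normGB_level_single, map_smul,
      smul_smul, neg_zero]
    congr 1
    push_cast
    ring
  · intro m j h
    rw [LinearMap.smul_apply]
    rcases le_or_gt 0 m with hm | hm
    · have e : m + j = m - (-j - 1) - 1 := by ring
      rw [e, Module.End.mul_apply, normGB_single_eq_zero π s n hn hm (by omega), map_zero,
        smul_zero]
    · obtain ⟨n', z', e⟩ := exists_normGB_single π s (-j - 1) (m + j) S n 1
      rw [hS.c_mul_apply_eq_zero ⟨S, n', z', e, fun _ => Iff.rfl⟩ (by omega), smul_zero]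

theorem qCtGB_single (π : Picture) (s : Sgn) {S : Finset FermiMode} (hS : LowFermi S)
    (n : BoseMode →₀ ℕ) (hn : ∀ j, j ≠ π.level s.opp → n (.ghost s.opp j) = 0) :
    qCtGB π s (Finsupp.single (S, n) 1) =
      (-(s.val : ℂ) * n (.ghost s.opp (π.level s.opp))) • ct 0 (Finsupp.single (S, n) 1) := by
  rw [qCtGB, modeSum_single_eq 0 (-π.level s.opp - 1)]
  · have e : -(-π.level s.opp - 1) - 1 = π.level s.opp := by ring
    rw [LinearMap.smul_apply, e, zero_add, Module.End.mul_apply, normGB_level_single, map_smul,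
      smul_smul, neg_zero]
    congr 1
    ring
  · intro m j h
    rw [LinearMap.smul_apply]
    rcases le_or_gt 0 m with hm | hm
    · have e : m + j = m - (-j - 1) - 1 := by ring
      rw [e, Module.End.mul_apply, normGB_single_eq_zero π s n hn hm (by omega), map_zero,
        smul_zero]
    · obtain ⟨n', z', e⟩ := exists_normGB_single π s (-j - 1) (m + j) S n 1
      rw [hS.ct_mul_apply_eq_zero ⟨S, n', z', e, fun _ => Iff.rfl⟩ (by omega), smul_zero]

/-! ### String coordinates and supercurrents -/

theorem a_single_eq_zero (k : Momentum) (s : Sgn) (μ : Fin 2) {m : ℤ} (hm : 1 ≤ m)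
    (S : Finset FermiMode) {n : BoseMode →₀ ℕ} (hn : ∀ s μ m, n (.alpha s μ m) = 0) (z : ℂ) :
    a k s μ m (Finsupp.single (S, n) z) = 0 := by
  obtain ⟨m, rfl⟩ : ∃ l : ℕ, m = Int.ofNat (l + 1) :=
    ⟨(m - 1).toNat, by simp only [Int.ofNat_eq_natCast]; omega⟩
  rw [a, LinearMap.smul_apply, annihB_single, hn]
  simp

theorem a_zero (k : Momentum) (s : Sgn) (μ : Fin 2) : a k s μ 0 = k.comp s μ • 1 := rfl

/-- Without oscillator excitations only the product of the two zero modes can survive, and it is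
`c_0` times half the momentum square. This is where the null condition enters. -/
theorem qBose_single {k : Momentum} (hk : k.sq = 0) {S : Finset FermiMode} (hS : LowFermi S)
    {n : BoseMode →₀ ℕ} (hn : ∀ s μ m, n (.alpha s μ m) = 0) :
    qBose k (Finsupp.single (S, n) 1) = 0 := by
  rw [qBose, modeSum_single_eq 0 0]
  · have h : ∀ μ, ((eta μ / 2 : ℝ) : ℂ) • (c (-(0 + 0)) * normAA k μ 0 0) =
        ((eta μ * Complex.normSq (k μ) / 2 : ℝ) : ℂ) • c 0 := fun μ => by
      rw [normAA, if_neg (lt_irrefl _), a_zero, a_zero, smul_mul_smul_comm, one_mul,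
        mul_smul_comm, mul_one, smul_smul]
      congr 1
      simp only [Momentum.comp, Complex.mul_conj]
      push_cast
      ring
    have h0 : (∑ μ, ((eta μ * Complex.normSq (k μ) / 2 : ℝ) : ℂ)) = 0 := by
      rw [← Complex.ofReal_sum, ← Finset.sum_div]
      rw [Momentum.sq] at hk
      rw [hk]
      simp
    simp only [h]
    rw [← Finset.sum_smul, h0, zero_smul, LinearMap.zero_apply]
  · intro i j h
    rw [LinearMap.sum_apply]
    refine Finset.sum_eq_zero fun μ _ => ?_
    rw [LinearMap.smul_apply]
    rcases le_or_gt 0 (i + j) with hp | hp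
    · have : normAA k μ i j (Finsupp.single (S, n) 1) = 0 := by
        rw [normAA]
        split_ifs with hj
        · rw [Module.End.mul_apply, a_single_eq_zero k _ μ (by omega) S hn, map_zero]
        · rw [Module.End.mul_apply]
          rcases le_or_gt 1 j with hj' | hj'
          · rw [a_single_eq_zero k _ μ hj' S hn, map_zero]
          · obtain rfl : j = 0 := by omega
            rw [a_zero, LinearMap.smul_apply, Module.End.one_apply, map_smul,
              a_single_eq_zero k _ μ (by omega) S hn, smul_zero]
      rw [Module.End.mul_apply, this, map_zero, smul_zero]
    · obtain ⟨n', z', e⟩ := exists_normAA_single k μ i j S n 1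
      rw [hS.c_mul_apply_eq_zero ⟨S, n', z', e, fun _ => Iff.rfl⟩ (by omega), smul_zero]

theorem gam_single_eq_zero {π : Picture} {s : Sgn} {j : ℤ} (hj : π.level s < j)
    (S : Finset FermiMode) {n : BoseMode →₀ ℕ} (hn : n (.ghost s j) = 0) (z : ℂ) :
    gam π s j (Finsupp.single (S, n) z) = 0 := by
  rw [gam, if_neg (by unfold gammaCreates; omega), annihB_single, hn]
  simp

theorem d_single_eq_zero (s : Sgn) (μ : Fin 2) (j : ℕ) {S : Finset FermiMode}
    (hS : .psi s.opp μ j ∉ S) (n : BoseMode →₀ ℕ) (z : ℂ) :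
    d s μ j (Finsupp.single (S, n) z) = 0 := by
  show (((2 * eta μ : ℝ) : ℂ) • annihF (.psi s.opp μ j)) _ = 0
  rw [LinearMap.smul_apply, annihF_single, if_neg hS]
  simp

/-- The supercurrent part of the BRST charge annihilates a state without excitations of the string
coordinates, provided that all remaining terms contain an unoccupied annihilation operator. -/
theorem qSuper_single_eq_zero {π : Picture} {k : Momentum} {s : Sgn} {S : Finset FermiMode}
    {n : BoseMode →₀ ℕ} (hn : ∀ s μ m, n (.alpha s μ m) = 0)
    (h : ∀ μ m j, m ≤ 0 → a k s μ m = 0 ∨ d s.opp μ j (Finsupp.single (S, n) 1) = 0 ∨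
      (π.level s < -(m + j + 1) ∧ n (.ghost s (-(m + j + 1))) = 0)) :
    qSuper π k s (Finsupp.single (S, n) 1) = 0 := by
  refine modeSum_single_eq_zero fun m j => ?_
  rw [LinearMap.neg_apply, LinearMap.sum_apply, neg_eq_zero]
  refine Finset.sum_eq_zero fun μ _ => ?_
  rw [LinearMap.smul_apply, Module.End.mul_apply, Module.End.mul_apply]
  obtain ⟨S', z', e, -⟩ := exists_d_single s.opp μ j S n 1
  rcases le_or_gt 1 m with hm | hm
  · rw [e, a_single_eq_zero k s μ hm S' hn, map_zero, smul_zero]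
  · rcases h μ m j (by omega) with h | h | ⟨h1, h2⟩
    · rw [h, LinearMap.zero_apply, map_zero, smul_zero]
    · rw [h, map_zero, map_zero, smul_zero]
    · obtain ⟨n', z'', e', h'⟩ := exists_a_single k s μ m S' n z'
      rw [e, e', gam_single_eq_zero h1 S' ((h' _ _).trans h2), smul_zero]

theorem level_picMZ_plus : picMZ.level .plus = 0 := rfl
theorem level_picMZ_minus : picMZ.level .minus = -1 := rfl
theorem level_picMM (s : Sgn) : picMM.level s = -1 := by cases s <;> rfl

/-- Zero momentum is essential: the terms with `m = 0`, such as `γ^+_{1/2} k^{+} d^{-}_{-1/2}`,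
consist of modes that need not annihilate light states. For `m < 0` either the matter mode or the
spinor ghost is an annihilator with nothing to remove. -/
theorem qSuper_picMZ_single (s : Sgn) {S : Finset FermiMode} (hS : LowFermi S)
    {n : BoseMode →₀ ℕ} (hn : LowBose n) :
    qSuper picMZ 0 s (Finsupp.single (S, n) 1) = 0 := by
  refine qSuper_single_eq_zero hn.alpha fun μ m j hm => ?_
  obtain rfl | hm := eq_or_lt_of_le hm
  · left
    have : Momentum.comp 0 s μ = 0 := by cases s <;> simp [Momentum.comp]
    rw [a_zero, this, zero_smul]
  right
  rcases lt_or_ge j 0 with hj | hj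
  · right
    cases s
    · rw [level_picMZ_plus]
      exact ⟨by omega, hn.plus _ (by omega)⟩
    · rw [level_picMZ_minus]
      exact ⟨by omega, hn.minus _ (by omega)⟩
  · lift j to ℕ using hj
    cases s
    · exact .inl (d_single_eq_zero _ _ _ (hS.psi_plus μ j) _ _)
    · by_cases h : .psi .minus μ j ∈ S
      · right
        obtain rfl := hS.psi_minus μ j h
        rw [level_picMZ_minus]
        exact ⟨by omega, hn.minus _ (by omega)⟩
      · exact .inl (d_single_eq_zero _ _ _ h _ _)

/-- Here the momentum does not matter: if the matter mode creates, then for `m ≤ 0` the ghost index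
is at least `0`, above the level `-1`, so the spinor ghost annihilates. This is why the massless
cohomology has a regular limit at zero momentum. -/
theorem qSuper_picMM_single (k : Momentum) (s : Sgn) {S : Finset FermiMode}
    (hS : ∀ t μ n, .psi t μ n ∉ S) :
    qSuper picMM k s (Finsupp.single (S, 0) 1) = 0 := by
  refine qSuper_single_eq_zero (fun _ _ _ => rfl) fun μ m j hm => ?_
  right
  rcases lt_or_ge j 0 with hj | hj
  · right
    rw [level_picMM]
    exact ⟨by omega, rfl⟩
  · lift j to ℕ using hj
    exact .inl (d_single_eq_zero _ _ _ (hS _ _ _) _ _)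

/-! ### The quadratic spinor ghost term -/

theorem exists_b_single (p : ℤ) (S : Finset FermiMode) (n : BoseMode →₀ ℕ) (z : ℂ) :
    ∃ S' z', b p (Finsupp.single (S, n) z) = Finsupp.single (S', n) z' := by
  rw [b]
  split_ifs
  · exact ⟨_, _, createF_single ..⟩
  · exact ⟨_, _, annihF_single ..⟩

theorem exists_bt_single (p : ℤ) (S : Finset FermiMode) (n : BoseMode →₀ ℕ) (z : ℂ) :
    ∃ S' z', bt p (Finsupp.single (S, n) z) = Finsupp.single (S', n) z' := by
  rw [bt]
  split_ifs
  · exact ⟨_, _, createF_single ..⟩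
  · exact ⟨_, _, annihF_single ..⟩

/-- `γ^-_r γ^+_s` annihilates a state if one of the factors is an annihilation operator without
anything to remove. -/
theorem gam_gam_single_eq_zero (π : Picture) (S : Finset FermiMode) {n : BoseMode →₀ ℕ} {i j : ℤ}
    (h : (π.level .minus < i ∧ n (.ghost .minus i) = 0) ∨
      (π.level .plus < j ∧ n (.ghost .plus j) = 0)) (z : ℂ) :
    gam π .minus i (gam π .plus j (Finsupp.single (S, n) z)) = 0 := by
  rcases h with ⟨h1, h2⟩ | ⟨h1, h2⟩
  · have : ∃ n' z', gam π .plus j (Finsupp.single (S, n) z) = Finsupp.single (S, n') z' ∧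
        n' (.ghost .minus i) = 0 := by
      rw [gam]
      split_ifs
      · exact ⟨_, _, createB_single .., by simp [h2]⟩
      · exact ⟨_, _, annihB_single .., by simp [h2]⟩
    obtain ⟨n', z', e, h3⟩ := this
    rw [e, gam_single_eq_zero h1 S h3]
  · rw [gam_single_eq_zero h1 S h2, map_zero]

theorem qGG_term_single_eq_zero (π : Picture) {S : Finset FermiMode} (hS : LowFermi S)
    {n : BoseMode →₀ ℕ} {i j : ℤ} (h : i + j + 1 ≤ 0 →
      (π.level .minus < -i - 1 ∧ n (.ghost .minus (-i - 1)) = 0) ∨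
      (π.level .plus < -j - 1 ∧ n (.ghost .plus (-j - 1)) = 0)) :
    (-(gam π .minus (-i - 1) * gam π .plus (-j - 1) *
      ((4 : ℂ) • b (i + j + 1) + (2 * ((i : ℂ) - j)) • bt (i + j + 1))))
        (Finsupp.single (S, n) 1) = 0 := by
  rw [LinearMap.neg_apply, neg_eq_zero, Module.End.mul_apply, LinearMap.add_apply,
    LinearMap.smul_apply, LinearMap.smul_apply]
  rcases le_or_gt 1 (i + j + 1) with hp | hp
  · rw [b_single_eq_zero hS n hp, bt_single_eq_zero hS n (by omega)]
    simp
  · obtain ⟨S₁, z₁, e₁⟩ := exists_b_single (i + j + 1) S n 1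
    obtain ⟨S₂, z₂, e₂⟩ := exists_bt_single (i + j + 1) S n 1
    rw [e₁, e₂, map_add, map_smul, map_smul, Module.End.mul_apply, Module.End.mul_apply,
      gam_gam_single_eq_zero π _ (h (by omega)), gam_gam_single_eq_zero π _ (h (by omega))]
    simp

/-- When `i + j + 1 ≤ 0` the two ghost indices add up to at least `-1`, so they cannot both be at
most the level `-1`. -/
theorem qGG_picMM_single {S : Finset FermiMode} (hS : LowFermi S) :
    qGG picMM (Finsupp.single (S, 0) 1) = 0 := by
  refine modeSum_single_eq_zero fun i j => qGG_term_single_eq_zero _ hS fun hp => ?_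
  simp only [level_picMM, Finsupp.coe_zero, Pi.zero_apply, and_true]
  omega

/-- Raising the level of `γ^+` to `0` opens exactly one slot: indices `-1` and `0`, multiplying
`b_0`. The companion `b̃_0` finds nothing to remove, and `c_0`, being first in the order, is removed
without a sign. This term is the origin of the picture dependence. -/
theorem qGG_picMZ_single {S : Finset FermiMode} (hS : LowFermi S) {n : BoseMode →₀ ℕ}
    (hn : LowBose n) : qGG picMZ (Finsupp.single (S, n) 1) =
      Finsupp.single (S.erase (.bc 0), n + Finsupp.single (.ghost .plus 0) 1 +
        Finsupp.single (.ghost .minus (-1)) 1) (if .bc 0 ∈ S then -4 else 0) := by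
  rw [qGG, modeSum_single_eq 0 (-1)]
  · rw [LinearMap.neg_apply, Module.End.mul_apply, Module.End.mul_apply, LinearMap.add_apply,
      LinearMap.smul_apply, LinearMap.smul_apply]
    norm_num only
    rw [bt_single_eq_zero hS n le_rfl, smul_zero, add_zero, b, if_neg (by omega), neg_zero,
      annihF_single, hS.fermiSign_bc_zero, gam, if_pos (by decide), gam, if_pos (by decide),
      map_smul, map_smul, createB_single, createB_single, Finsupp.smul_single,
      ← Finsupp.single_neg]
    congr 1
    split_ifs <;> simp
  · intro i j h
    refine qGG_term_single_eq_zero _ hS fun hp => ?_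
    rw [level_picMZ_plus, level_picMZ_minus]
    rcases lt_or_ge (-1) (-i - 1) with h1 | h1
    · exact .inl ⟨h1, hn.minus _ (by omega)⟩
    · exact .inr ⟨by omega, hn.plus _ (by omega)⟩

/-- The BRST charge on the light states of the `(-1,0)` picture at zero momentum. -/
theorem Q_picMZ_single {S : Finset FermiMode} (hS : LowFermi S) {n : BoseMode →₀ ℕ}
    (hn : LowBose n) : Q picMZ 0 (Finsupp.single (S, n) 1) =
      ((numPsi S - n (.ghost .plus 0) + n (.ghost .minus (-1)) - 1) / 2) •
          c 0 (Finsupp.single (S, n) 1) +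
        (1 - numPsi S + n (.ghost .plus 0) - n (.ghost .minus (-1))) •
          ct 0 (Finsupp.single (S, n) 1) +
        Finsupp.single (S.erase (.bc 0), n + Finsupp.single (.ghost .plus 0) 1 +
          Finsupp.single (.ghost .minus (-1)) 1) (if .bc 0 ∈ S then -4 else 0) := by
  have hsq : Momentum.sq 0 = 0 := by simp [Momentum.sq]
  have hv : (vacWeight picMZ : ℂ) = 1 / 2 := by norm_num [vacWeight, picMZ]
  have hc : (vacCharge picMZ : ℂ) = 1 := by norm_num [vacCharge, picMZ]
  simp only [Q, LinearMap.add_apply, LinearMap.smul_apply, qBose_single hsq hS hn.alpha,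
    qFermi_single hS, qCurrent_single hS, qSuper_picMZ_single _ hS hn, qCCB_single hS,
    qCCtBt_single hS, qCGB_single picMZ .plus hS n hn.minus,
    qCGB_single picMZ .minus hS n hn.plus, qCtGB_single picMZ .plus hS n hn.minus,
    qCtGB_single picMZ .minus hS n hn.plus, qGG_picMZ_single hS hn, hv, hc, Sgn.opp, Sgn.val,
    level_picMZ_plus, level_picMZ_minus]
  push_cast
  module

/-- The BRST charge on the light states of the `(-1,-1)` picture. -/
theorem Q_picMM_single {k : Momentum} (hk : k.sq = 0) {S : Finset FermiMode} (hS : LowFermi S)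
    (hpsi : ∀ t μ n, .psi t μ n ∉ S) : Q picMM k (Finsupp.single (S, 0) 1) = 0 := by
  have hv : (vacWeight picMM : ℂ) = 1 := by norm_num [vacWeight, picMM]
  have hc : (vacCharge picMM : ℂ) = 0 := by norm_num [vacCharge, picMM]
  have hN : numPsi S = 0 := Finset.sum_eq_zero fun μ _ => if_neg (hpsi _ _ _)
  simp only [Q, LinearMap.add_apply, LinearMap.smul_apply,
    qBose_single hk hS (n := 0) (fun _ _ _ => rfl),
    qFermi_single hS, qCurrent_single hS, qSuper_picMM_single k _ hpsi, qCCB_single hS,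
    qCCtBt_single hS, qCGB_single picMM _ hS 0 (fun _ _ => rfl),
    qCtGB_single picMM _ hS 0 (fun _ _ => rfl), qGG_picMM_single hS, hv, hc, hN]
  simp

/-! ### Spaces of states spanned by occupation number states -/

/-- The span of the occupation number states in a set. -/
noncomputable abbrev spanOcc (A : Set Occ) : Submodule ℂ Fock := Finsupp.supported ℂ ℂ A

theorem spanOcc_eq_span (A : Set Occ) :
    spanOcc A = Submodule.span ℂ ((fun e => Finsupp.single e 1) '' A) :=
  Finsupp.supported_eq_span_single ℂ A

theorem single_mem_spanOcc {A : Set Occ} {e : Occ} (he : e ∈ A) (z : ℂ) :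
    (Finsupp.single e z : Fock) ∈ spanOcc A :=
  Finsupp.single_mem_supported ℂ z he

theorem mem_spanOcc {A : Set Occ} {ψ : Fock} : ψ ∈ spanOcc A ↔ ∀ e, e ∉ A → ψ e = 0 :=
  Finsupp.mem_supported' ℂ ψ

theorem spanOcc_inf (A B : Set Occ) : spanOcc A ⊓ spanOcc B = spanOcc (A ∩ B) :=
  (Finsupp.supported_inter A B).symm

theorem onBasis_diagonal_apply (f : Occ → ℂ) (ψ : Fock) (e : Occ) :
    onBasis (fun e => Finsupp.single e (f e)) ψ e = f e * ψ e := by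
  induction ψ using Finsupp.induction_linear with
  | zero => simp
  | add x y hx hy => rw [map_add, Finsupp.add_apply, hx, hy, Finsupp.add_apply, mul_add]
  | single e' z =>
    rw [onBasis_single, Finsupp.smul_apply]
    by_cases h : e' = e
    · subst h; simp [mul_comm]
    · simp [h]

theorem ker_sub_smul_diagonal (f : Occ → ℂ) (w : ℂ) :
    LinearMap.ker (onBasis (fun e => Finsupp.single e (f e)) - w • 1) =
      spanOcc {e | f e = w} := by
  ext ψ
  rw [LinearMap.mem_ker, mem_spanOcc, Finsupp.ext_iff]
  refine forall_congr' fun e => ?_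
  rw [LinearMap.sub_apply, Finsupp.sub_apply, onBasis_diagonal_apply, LinearMap.smul_apply,
    Module.End.one_apply, Finsupp.smul_apply, smul_eq_mul, ← sub_mul, Finsupp.zero_apply,
    mul_eq_zero, sub_eq_zero, Set.mem_ofPred_eq]
  tauto

theorem ker_diagonal (f : Occ → ℂ) :
    LinearMap.ker (onBasis fun e => Finsupp.single e (f e)) = spanOcc {e | f e = 0} := by
  rw [← ker_sub_smul_diagonal f 0, zero_smul, sub_zero]

/-- Creation after annihilation is the diagonal projection onto occupied states, so a vector killed
by the annihilator has no component there. -/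
theorem ker_annihF (i : FermiMode) : LinearMap.ker (annihF i) = spanOcc {e | i ∉ e.1} := by
  apply le_antisymm
  · have h : createF i * annihF i =
        onBasis fun e => Finsupp.single e (if i ∈ e.1 then 1 else 0) := by
      refine Finsupp.lhom_ext fun ⟨S, n⟩ z => ?_
      rw [Module.End.mul_apply, createF_annihF_single, onBasis_single]
      split_ifs <;> simp
    intro ψ hψ
    have : (createF i * annihF i) ψ = 0 := by
      rw [Module.End.mul_apply, LinearMap.mem_ker.1 hψ, map_zero]
    rw [h, ← LinearMap.mem_ker, ker_diagonal] at this
    simpa using this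
  · rw [spanOcc_eq_span, Submodule.span_le]
    rintro _ ⟨⟨S, n⟩, he, rfl⟩
    have he' : i ∉ S := he
    simp [annihF_single, he']

/-- The occupations spanning `F`. -/
def occF (π : Picture) (k : Momentum) : Set Occ :=
  {e | weight π k e = 0 ∧ charge π e = 0 ∧ .bct 0 ∉ e.1}

theorem F_eq_spanOcc (π : Picture) (k : Momentum) : F π k = spanOcc (occF π k) := by
  have hb : bt 0 = annihF (.bct 0) := by simp [bt]
  rw [F, L0, J0, hb, ker_diagonal, ker_diagonal, ker_annihF, spanOcc_inf, spanOcc_inf]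
  congr 1
  ext e
  simp [occF, and_assoc]

theorem Frel_eq_spanOcc (π : Picture) (k : Momentum) :
    Frel π k = spanOcc (occF π k ∩ {e | .bc 0 ∉ e.1}) := by
  have hb : b 0 = annihF (.bc 0) := by simp [b]
  rw [Frel, F_eq_spanOcc, hb, ker_annihF, spanOcc_inf]

theorem ghostPart_spanOcc (π : Picture) (A : Set Occ) (g : ℤ) :
    ghostPart π (spanOcc A) g = spanOcc (A ∩ {e | ghostNumber π e = g}) := by
  rw [ghostPart, ghostOp, ker_sub_smul_diagonal, spanOcc_inf]
  simp

theorem map_eq_bot {A : Op} {T : Set Occ} (h : ∀ e ∈ T, A (Finsupp.single e 1) = 0) :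
    (spanOcc T).map A = ⊥ := by
  rw [spanOcc_eq_span, Submodule.map_span, Submodule.span_eq_bot]
  rintro _ ⟨_, ⟨e, he, rfl⟩, rfl⟩
  exact h e he

theorem apply_eq_zero_of_mem_spanOcc {A : Op} {T : Set Occ}
    (h : ∀ e ∈ T, A (Finsupp.single e 1) = 0) {ψ : Fock} (hψ : ψ ∈ spanOcc T) : A ψ = 0 := by
  have := Submodule.mem_map_of_mem (f := A) hψ
  rwa [map_eq_bot h, Submodule.mem_bot] at this

/-! ### Operators that shift some basis states and kill the rest -/

section PartialShift

variable {A : Op} {T P : Set Occ} {σ : Occ → Occ} {κ : ℂ}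

/-- An operator that maps some basis states injectively to multiples of basis states and
annihilates the others: its image. -/
theorem map_spanOcc_of_shift (hκ : κ ≠ 0)
    (h₁ : ∀ e ∈ T ∩ P, A (Finsupp.single e 1) = Finsupp.single (σ e) κ)
    (h₀ : ∀ e ∈ T \ P, A (Finsupp.single e 1) = 0) :
    (spanOcc T).map A = spanOcc (σ '' (T ∩ P)) := by
  apply le_antisymm
  · rw [spanOcc_eq_span, Submodule.map_span, Submodule.span_le]
    rintro _ ⟨_, ⟨e, he, rfl⟩, rfl⟩
    by_cases hP : e ∈ P
    · have heP : e ∈ T ∩ P := ⟨he, hP⟩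
      simp only [h₁ e heP]
      exact single_mem_spanOcc (Set.mem_image_of_mem _ heP) κ
    · simp only [h₀ e ⟨he, hP⟩]
      exact zero_mem _
  · rw [spanOcc_eq_span (σ '' _), Submodule.span_le]
    rintro _ ⟨_, ⟨e, he, rfl⟩, rfl⟩
    refine ⟨Finsupp.single e κ⁻¹, single_mem_spanOcc he.1 _, ?_⟩
    rw [show (Finsupp.single e κ⁻¹ : Fock) = κ⁻¹ • Finsupp.single e 1 by simp, map_smul, h₁ e he,
      Finsupp.smul_single, smul_eq_mul, inv_mul_cancel₀ hκ]

/-- The kernel of an operator as in `map_spanOcc_of_shift`. -/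
theorem spanOcc_inf_ker_of_shift (hκ : κ ≠ 0)
    (h₁ : ∀ e ∈ T ∩ P, A (Finsupp.single e 1) = Finsupp.single (σ e) κ)
    (h₀ : ∀ e ∈ T \ P, A (Finsupp.single e 1) = 0) (hσ : Set.InjOn σ (T ∩ P)) :
    spanOcc T ⊓ LinearMap.ker A = spanOcc (T \ P) := by
  apply le_antisymm
  · rintro ψ ⟨hT, hA⟩
    -- Injectivity of `σ` lets the coefficient of `A φ` at `σ e` recover that of `φ` at `e`, so no
    -- cancellation can occur in the kernel.
    have key : ∀ e ∈ T ∩ P, ∀ φ ∈ spanOcc T, A φ (σ e) = κ * φ e := by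
      intro e he φ hφ
      rw [spanOcc_eq_span] at hφ
      induction hφ using Submodule.span_induction with
      | zero => simp
      | add x y _ _ hx hy => rw [map_add, Finsupp.add_apply, hx, hy, Finsupp.add_apply, mul_add]
      | smul z x _ hx =>
        rw [map_smul, Finsupp.smul_apply, hx, Finsupp.smul_apply, smul_eq_mul, smul_eq_mul]
        ring
      | mem x hx =>
        obtain ⟨e', he', rfl⟩ := hx
        by_cases hP : e' ∈ P
        · simp only [h₁ e' ⟨he', hP⟩]
          by_cases hee : e' = e
          · subst hee; simp
          · rw [Finsupp.single_eq_of_ne fun hh => hee (hσ ⟨he', hP⟩ he hh.symm),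
              Finsupp.single_eq_of_ne (Ne.symm hee), mul_zero]
        · simp only [h₀ e' ⟨he', hP⟩]
          have hee : e ≠ e' := by rintro rfl; exact hP he.2
          rw [Finsupp.single_eq_of_ne hee, mul_zero, Finsupp.zero_apply]
    rw [mem_spanOcc]
    intro e he
    by_cases heT : e ∈ T
    · have heP : e ∈ P := by by_contra hP; exact he ⟨heT, hP⟩
      have := key e ⟨heT, heP⟩ ψ hT
      rw [LinearMap.mem_ker.1 hA, Finsupp.zero_apply, eq_comm, mul_eq_zero] at this
      exact this.resolve_left hκ
    · exact mem_spanOcc.1 hT e heT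
  · intro ψ hψ
    exact ⟨Finsupp.supported_mono Set.sdiff_subset hψ, apply_eq_zero_of_mem_spanOcc h₀ hψ⟩

end PartialShift

/-! ### Cohomology when closed and exact states are coordinate subspaces -/

section Cohomology

variable {π : Picture} {k : Momentum} {V : Submodule ℂ Fock} {g : ℤ} {A B : Set Occ}

/-- Modulo the coordinate subspace on `B`, the basis states in `A` but not in `B` stay independent
and all others in `A` become zero. -/
theorem classesFormBasis_of_spanOcc {ι : Type} (hc : cocycles π k V g = spanOcc A)
    (hb : coboundaries π k V g = spanOcc B) {x : ι → Occ} (hx : Function.Injective x)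
    (hAB : ∀ e, e ∈ A \ B ↔ e ∈ Set.range x) :
    ClassesFormBasis π k V g fun i => Finsupp.single (x i) 1 := by
  have hxA : ∀ i, x i ∈ A \ B := fun i => (hAB _).2 ⟨i, rfl⟩
  refine ⟨fun i => hc ▸ single_mem_spanOcc (hxA i).1 1, ?_, ?_⟩
  · classical
    rw [linearIndependent_iff']
    intro s w hw i hi
    have hw' : (Submodule.Quotient.mk (∑ j ∈ s, w j •
        (⟨Finsupp.single (x j) 1, hc ▸ single_mem_spanOcc (hxA j).1 1⟩ : cocycles π k V g)) :
          Coh π k V g) = 0 :=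
      (map_sum (Submodule.mkQ _) _ s).trans hw
    rw [Submodule.Quotient.mk_eq_zero, Submodule.submoduleOf, Submodule.mem_comap, hb, map_sum,
      mem_spanOcc] at hw'
    -- A combination that is exact is supported in `B`; its coefficient at `x i`, which lies outside
    -- `B`, is therefore zero.
    have := hw' (x i) (hxA i).2
    simpa [Finsupp.finsetSum_apply, Finsupp.single_apply, hx.eq_iff, hi] using this
  · rw [eq_top_iff]
    set cls : ι → Coh π k V g := fun i => Submodule.Quotient.mk
      ⟨Finsupp.single (x i) 1, hc ▸ single_mem_spanOcc (hxA i).1 1⟩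
    have hle : spanOcc A ≤ ((Submodule.span ℂ (Set.range cls)).comap
        (Submodule.mkQ _)).map (cocycles π k V g).subtype := by
      rw [spanOcc_eq_span, Submodule.span_le]
      rintro _ ⟨e, he, rfl⟩
      refine ⟨⟨Finsupp.single e 1, hc ▸ single_mem_spanOcc he 1⟩, ?_, rfl⟩
      rw [SetLike.mem_coe, Submodule.mem_comap, Submodule.mkQ_apply]
      by_cases heB : e ∈ B
      · have : (Submodule.Quotient.mk ⟨Finsupp.single e 1, hc ▸ single_mem_spanOcc he 1⟩ :
            Coh π k V g) = 0 := by
          rw [Submodule.Quotient.mk_eq_zero, Submodule.submoduleOf, Submodule.mem_comap, hb]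
          exact single_mem_spanOcc heB 1
        rw [this]
        exact zero_mem _
      · obtain ⟨i, rfl⟩ := (hAB e).1 ⟨he, heB⟩
        exact Submodule.subset_span ⟨i, rfl⟩
    intro q _
    obtain ⟨⟨ψ, hψ⟩, rfl⟩ := Submodule.Quotient.mk_surjective _ q
    obtain ⟨φ, hφ, rfl⟩ := hle (hc ▸ hψ)
    exact hφ

theorem subsingleton_coh_of_spanOcc (hc : cocycles π k V g = spanOcc A)
    (hb : coboundaries π k V g = spanOcc B) (hAB : A ⊆ B) : Subsingleton (Coh π k V g) := by
  rw [Submodule.Quotient.subsingleton_iff, eq_top_iff]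
  rintro ⟨ψ, hψ⟩ -
  rw [Submodule.submoduleOf, Submodule.mem_comap, hb]
  rw [hc] at hψ
  exact Finsupp.supported_mono hAB hψ

theorem ClassesFormBasis.rank_eq {ι : Type} [Fintype ι] {x : ι → Fock}
    (h : ClassesFormBasis π k V g x) : Module.rank ℂ (Coh π k V g) = Fintype.card ι := by
  obtain ⟨hx, hli, hsp⟩ := h
  exact rank_eq_card_basis (Module.Basis.mk hli hsp.ge)

/-- Being closed includes both the ghost number and being killed by `Q`, so one inclusion yields the
grading and nilpotency. -/
theorem isBRSTComplex_of_le (h : ∀ g, coboundaries π k V g ≤ cocycles π k V g) :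
    IsBRSTComplex π k V := by
  intro g ψ hψ
  have : Q π k ψ ∈ cocycles π k V (g + 1) :=
    h (g + 1) ⟨ψ, by rwa [add_sub_cancel_right], rfl⟩
  exact ⟨this.1, this.2⟩

end Cohomology

/-! ### The occupations spanning the BRST complexes -/

/-- The only negative contribution is that of `c_1`, which is fermionic and can occur once, just
cancelling the vacuum value `w`. Everything else is non-negative and must vanish term by term. -/
theorem forall_eq_zero_of_add_sum_eq_zero {u : FermiMode → ℝ} {v : BoseMode → ℝ} {w : ℝ}
    (hw : 0 < w) (hu₁ : u (.bc 1) = -w) (hu : ∀ i, i ≠ .bc 1 → 0 ≤ u i) (hv : ∀ i, 0 ≤ v i)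
    {e : Occ} (h : w + ∑ i ∈ e.1, u i + (e.2.sum fun i n => (n : ℝ) * v i) = 0) :
    .bc 1 ∈ e.1 ∧ (∀ i ∈ e.1, i ≠ .bc 1 → u i = 0) ∧ ∀ i, v i ≠ 0 → e.2 i = 0 := by
  have hB : ∀ i ∈ e.2.support, 0 ≤ (e.2 i : ℝ) * v i := fun i _ => by
    have := hv i; positivity
  have hB' : 0 ≤ e.2.sum fun i n => (n : ℝ) * v i := Finset.sum_nonneg hB
  have hF : ∀ i ∈ e.1.erase (.bc 1), 0 ≤ u i := fun i hi => hu i (Finset.ne_of_mem_erase hi)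
  have hF' := Finset.sum_nonneg hF
  by_cases h1 : .bc 1 ∈ e.1
  · rw [← Finset.add_sum_erase _ _ h1, hu₁] at h
    refine ⟨h1, fun i hi hne => ?_, fun i hi => ?_⟩
    · exact (Finset.sum_eq_zero_iff_of_nonneg hF).1 (by linarith) i
        (Finset.mem_erase.2 ⟨hne, hi⟩)
    · by_contra hne
      have := (Finset.sum_eq_zero_iff_of_nonneg hB).1
        (by rw [Finsupp.sum] at h hB'; linarith) i (Finsupp.mem_support_iff.2 hne)
      rcases mul_eq_zero.1 this with h0 | h0
      · exact hne (by exact_mod_cast h0)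
      · exact hi h0
  · rw [Finset.erase_eq_of_notMem h1] at hF'
    linarith

theorem weight_eq (π : Picture) (k : Momentum) (e : Occ) : weight π k e =
    vacWeight π + k.sq / 2 + ∑ i ∈ e.1, i.energy + e.2.sum fun i n => (n : ℝ) * i.energy π := rfl

theorem picMZ_low {e : Occ} (h : e ∈ occF picMZ 0) : LowFermi e.1 ∧ LowBose e.2 := by
  obtain ⟨hw, hc, hbt⟩ := h
  have hc' : (1 : ℝ) + ∑ i ∈ e.1, (i.charge : ℝ) +
      (e.2.sum fun i n => (n : ℝ) * (i.charge picMZ : ℝ)) = 0 := by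
    have := congrArg (fun z : ℤ => (z : ℝ)) hc
    simpa [charge, vacCharge, picMZ, Finsupp.sum] using this
  have hw' : (1 : ℝ) / 2 + ∑ i ∈ e.1, i.energy +
      (e.2.sum fun i n => (n : ℝ) * i.energy picMZ) = 0 := by
    rw [weight_eq] at hw
    have hv : vacWeight picMZ = 1 / 2 := by norm_num [vacWeight, picMZ]
    have hsq : Momentum.sq 0 = 0 := by simp [Momentum.sq]
    rwa [hv, hsq, zero_div, add_zero] at hw
  -- The combination `2 L_0 + J_0` has vacuum value `2 · 1/2 + 1 = 2`. The charge `+1` of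
  -- `γ^+_{1/2}` compensates its negative weight, and the charge `-1` of `d^{-μ}_{-1/2}` and of
  -- `γ^-_{-1/2}` cancels their positive weight.
  have key := forall_eq_zero_of_add_sum_eq_zero (w := 2) (u := fun i => 2 * i.energy + i.charge)
    (v := fun i => 2 * i.energy picMZ + i.charge picMZ) (e := e) two_pos
    (by norm_num [FermiMode.energy, FermiMode.charge])
    (by
      rintro (q | q | ⟨_ | _, μ, n⟩) hi <;>
        simp only [FermiMode.energy, FermiMode.charge, Sgn.val] <;> (try split_ifs with hq)
      · have : q ≤ 0 := by
          rcases hq.lt_or_eq with h | h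
          · omega
          · exact (hi (by rw [h])).elim
        have : (q : ℝ) ≤ 0 := by exact_mod_cast this
        push_cast; linarith
      · have : (0 : ℝ) ≤ q := by exact_mod_cast (by omega : 0 ≤ q)
        push_cast; linarith
      · have : (q : ℝ) ≤ 0 := by exact_mod_cast hq
        push_cast; linarith
      · have : (0 : ℝ) ≤ q := by exact_mod_cast (by omega : 0 ≤ q)
        push_cast; linarith
      · push_cast; positivity
      · push_cast; linarith [(Nat.cast_nonneg n : (0 : ℝ) ≤ n)])
    (by
      rintro (⟨s, μ, n⟩ | ⟨_ | _, j⟩) <;>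
        simp only [BoseMode.energy, BoseMode.charge, Sgn.val, gammaCreates, level_picMZ_plus,
          level_picMZ_minus]
      · push_cast; positivity
      · by_cases hq : j ≤ 0 <;> simp only [hq, if_true, if_false]
        · have : (j : ℝ) ≤ 0 := by exact_mod_cast hq
          push_cast; linarith
        · have : (1 : ℝ) ≤ j := by exact_mod_cast (by omega : 1 ≤ j)
          push_cast; linarith
      · by_cases hq : j ≤ -1 <;> simp only [hq, if_true, if_false]
        · have : (j : ℝ) ≤ -1 := by exact_mod_cast hq
          push_cast; linarith
        · have : (0 : ℝ) ≤ j := by exact_mod_cast (by omega : 0 ≤ j)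
          push_cast; linarith)
    (by
      rw [Finset.sum_add_distrib, ← Finset.mul_sum]
      simp only [mul_add, Finsupp.sum, Finset.sum_add_distrib] at hw' hc' ⊢
      simp only [mul_left_comm _ (2 : ℝ), ← Finset.mul_sum]
      linarith)
  obtain ⟨h1, hF, hB⟩ := key
  refine ⟨⟨h1, fun q hq => ?_, fun q hq => ?_, fun μ n hm => ?_, fun μ n hm => ?_⟩,
    ⟨fun s μ m => hB _ ?_, fun j hj => hB _ ?_, fun j hj => hB _ ?_⟩⟩
  · by_cases hq1 : q = 1
    · exact .inr hq1
    · left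
      have := hF _ hq (by simpa using hq1)
      simp only [FermiMode.energy, FermiMode.charge] at this
      split_ifs at this <;> exact_mod_cast (by push_cast at this; linarith : (q : ℝ) = 0)
  · have h0 : q = 0 := by
      have := hF _ hq (by simp)
      simp only [FermiMode.energy, FermiMode.charge] at this
      split_ifs at this <;> exact_mod_cast (by push_cast at this; linarith : (q : ℝ) = 0)
    subst h0
    exact hbt hq
  · have := hF _ hm (by simp)
    simp only [FermiMode.energy, FermiMode.charge, Sgn.val] at this
    push_cast at this
    linarith [(Nat.cast_nonneg n : (0 : ℝ) ≤ n)]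
  · have := hF _ hm (by simp)
    simp only [FermiMode.energy, FermiMode.charge, Sgn.val] at this
    exact_mod_cast (by push_cast at this; linarith : (n : ℝ) = 0)
  · simp only [BoseMode.energy, BoseMode.charge]
    push_cast
    positivity
  · have hj' : (j : ℝ) ≠ 0 := by exact_mod_cast hj
    simp only [BoseMode.energy, BoseMode.charge, Sgn.val]
    split_ifs <;> push_cast <;> intro h <;> apply hj' <;> linarith
  · simp only [BoseMode.energy, BoseMode.charge, Sgn.val, gammaCreates, level_picMZ_minus]
    by_cases hq : j ≤ -1 <;> simp only [hq, if_true, if_false]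
    · have hj' : (j : ℝ) ≠ -1 := by exact_mod_cast hj
      push_cast
      intro h
      apply hj'
      linarith
    · have : (0 : ℝ) ≤ j := by exact_mod_cast (by omega : 0 ≤ j)
      push_cast
      intro h
      linarith

/-- The state `c_1 |-1,-1,k⟩`. -/
def occC : Occ := ({.bc 1}, 0)

/-- The state `c_0 c_1 |-1,-1,k⟩`. -/
def occCC : Occ := ({.bc 0, .bc 1}, 0)

theorem vacWeight_picMM : vacWeight picMM = 1 := by norm_num [vacWeight, picMM]

/-- All spinor ghost creation modes now have strictly positive weight, so `L_0` alone is used for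
the bound. The only remaining modes of weight zero are `c_0` and `c̃_0`, and `b̃_0` forbids the
latter. -/
theorem occF_picMM {k : Momentum} (hk : k.sq = 0) : occF picMM k = {occC, occCC} := by
  ext e
  rw [Set.mem_insert_iff, Set.mem_singleton_iff]
  constructor
  · rintro ⟨hw, -, hbt⟩
    rw [weight_eq, vacWeight_picMM, hk, zero_div, add_zero] at hw
    obtain ⟨h1, hF, hB⟩ := forall_eq_zero_of_add_sum_eq_zero (w := 1) (u := FermiMode.energy)
      (v := fun i => i.energy picMM) (e := e) one_pos
      (by norm_num [FermiMode.energy])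
      (by
        rintro (q | q | ⟨s, μ, n⟩) hi <;>
          simp only [FermiMode.energy] <;> (try split_ifs with hq)
        · have : q ≤ 0 := by
            rcases hq.lt_or_eq with h | h
            · omega
            · exact (hi (by rw [h])).elim
          have : (q : ℝ) ≤ 0 := by exact_mod_cast this
          linarith
        · exact_mod_cast (by omega : 0 ≤ q)
        · have : (q : ℝ) ≤ 0 := by exact_mod_cast hq
          linarith
        · exact_mod_cast (by omega : 0 ≤ q)
        · positivity)
      (by
        rintro (⟨s, μ, n⟩ | ⟨s, j⟩) <;>
          simp only [BoseMode.energy, gammaCreates, level_picMM] <;> (try split_ifs with hq)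
        · positivity
        · have : (j : ℝ) ≤ -1 := by exact_mod_cast hq
          linarith
        · have : (0 : ℝ) ≤ j := by exact_mod_cast (by omega : 0 ≤ j)
          linarith) hw
    have h2 : e.2 = 0 := by
      ext i
      refine hB i ?_
      rcases i with ⟨s, μ, n⟩ | ⟨s, j⟩ <;>
          simp only [BoseMode.energy, gammaCreates, level_picMM] <;> (try split_ifs with hq)
      · positivity
      · have : (j : ℝ) ≤ -1 := by exact_mod_cast hq
        intro h; linarith
      · have : (0 : ℝ) ≤ j := by exact_mod_cast (by omega : 0 ≤ j)
        intro h; linarith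
    have h3 : ∀ i ∈ e.1, i = .bc 0 ∨ i = .bc 1 := by
      intro i hi
      by_cases hi1 : i = .bc 1
      · exact .inr hi1
      have h0 := hF i hi hi1
      rcases i with q | q | ⟨s, μ, n⟩ <;> simp only [FermiMode.energy] at h0
      · left
        rw [show q = 0 by split_ifs at h0 <;> exact_mod_cast (by linarith : (q : ℝ) = 0)]
      · have : q = 0 := by split_ifs at h0 <;> exact_mod_cast (by linarith : (q : ℝ) = 0)
        subst this
        exact (hbt hi).elim
      · linarith [(Nat.cast_nonneg n : (0 : ℝ) ≤ n)]
    by_cases h0 : .bc 0 ∈ e.1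
    · refine .inr (Prod.ext ?_ h2)
      ext i
      simp only [occCC, Finset.mem_insert, Finset.mem_singleton]
      exact ⟨h3 i, by rintro (rfl | rfl) <;> assumption⟩
    · refine .inl (Prod.ext ?_ h2)
      ext i
      simp only [occC, Finset.mem_singleton]
      refine ⟨fun hi => (h3 i hi).resolve_left fun h => h0 (h ▸ hi), ?_⟩
      rintro rfl
      exact h1
  · have hv := vacWeight_picMM
    have hc : vacCharge picMM = 0 := by simp [vacCharge, picMM]
    rintro (rfl | rfl) <;> refine ⟨?_, ?_, ?_⟩ <;>
      simp [weight_eq, charge, occC, occCC, hv, hc, hk, FermiMode.energy, FermiMode.charge]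

/-! ### Parametrising the light states of the `(-1,0)` picture -/

/-- The occupation of `c_1` and of `d^{-μ}_{-1/2}`, `μ ∈ T`. -/
def lowFermi (T : Finset (Fin 2)) : Finset FermiMode :=
  insert (.bc 1) (T.image fun μ => .psi .minus μ 0)

/-- `α` quanta of `γ^+_{1/2}` and `β` quanta of `γ^-_{-1/2}`. -/
noncomputable def lowBose (α β : ℕ) : BoseMode →₀ ℕ :=
  Finsupp.single (.ghost .plus 0) α + Finsupp.single (.ghost .minus (-1)) β

theorem lowBose_plus (α β : ℕ) : lowBose α β (.ghost .plus 0) = α := by simp [lowBose]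

theorem lowBose_minus (α β : ℕ) : lowBose α β (.ghost .minus (-1)) = β := by simp [lowBose]

theorem lowBose_inj {α β α' β' : ℕ} (h : lowBose α β = lowBose α' β') : α = α' ∧ β = β' := by
  constructor
  · rw [← lowBose_plus α β, h, lowBose_plus]
  · rw [← lowBose_minus α β, h, lowBose_minus]

theorem psi_mem_lowFermi {T : Finset (Fin 2)} {μ : Fin 2} :
    .psi .minus μ 0 ∈ lowFermi T ↔ μ ∈ T := by simp [lowFermi]

theorem bc_zero_notMem_lowFermi (T : Finset (Fin 2)) : .bc 0 ∉ lowFermi T := by simp [lowFermi]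

theorem lowFermi_injective : Function.Injective lowFermi := fun T T' h => by
  ext μ
  rw [← psi_mem_lowFermi, h, psi_mem_lowFermi]

theorem lowFermi_isLow (T : Finset (Fin 2)) : LowFermi (lowFermi T) := by
  constructor <;> simp +contextual [lowFermi, eq_comm]

theorem insert_lowFermi_isLow (T : Finset (Fin 2)) : LowFermi (insert (.bc 0) (lowFermi T)) := by
  constructor <;> simp +contextual [lowFermi, eq_comm]

theorem lowBose_isLow (α β : ℕ) : LowBose (lowBose α β) := by
  constructor <;> simp +contextual [lowBose, eq_comm]

theorem LowFermi.eq_lowFermi {S : Finset FermiMode} (hS : LowFermi S) (h : .bc 0 ∉ S) :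
    S = lowFermi (Finset.univ.filter fun μ => .psi .minus μ 0 ∈ S) := by
  ext i
  simp only [lowFermi, Finset.mem_insert, Finset.mem_image, Finset.mem_filter, Finset.mem_univ,
    true_and]
  constructor
  · intro hi
    rcases i with q | q | ⟨_ | _, μ, n⟩
    · rcases hS.bc_le q hi with rfl | rfl
      · exact (h hi).elim
      · exact .inl rfl
    · exact (hS.bct q hi).elim
    · exact (hS.psi_plus μ n hi).elim
    · obtain rfl := hS.psi_minus μ n hi
      exact .inr ⟨μ, hi, rfl⟩
  · rintro (rfl | ⟨μ, hμ, rfl⟩)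
    · exact hS.bc_one
    · exact hμ

theorem LowBose.eq_lowBose {n : BoseMode →₀ ℕ} (hn : LowBose n) :
    n = lowBose (n (.ghost .plus 0)) (n (.ghost .minus (-1))) := by
  classical
  ext i
  rcases i with ⟨s, μ, m⟩ | ⟨_ | _, j⟩
  · rw [hn.alpha, (lowBose_isLow _ _).alpha]
  · by_cases hj : j = 0
    · rw [hj, lowBose_plus]
    · rw [hn.plus j hj, (lowBose_isLow _ _).plus j hj]
  · by_cases hj : j = -1
    · rw [hj, lowBose_minus]
    · rw [hn.minus j hj, (lowBose_isLow _ _).minus j hj]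

theorem numPsi_lowFermi (T : Finset (Fin 2)) : numPsi (lowFermi T) = T.card := by
  simp [numPsi, psi_mem_lowFermi]

theorem numPsi_insert (S : Finset FermiMode) : numPsi (insert (.bc 0) S) = numPsi S := by
  simp [numPsi]

theorem sum_lowFermi {M : Type*} [AddCommMonoid M] (u : FermiMode → M) (T : Finset (Fin 2)) :
    ∑ i ∈ lowFermi T, u i = u (.bc 1) + ∑ μ ∈ T, u (.psi .minus μ 0) := by
  rw [lowFermi, Finset.sum_insert (by simp), Finset.sum_image (by simp)]

theorem sum_lowBose {M : Type*} [NonAssocSemiring M] (v : BoseMode → M) (α β : ℕ) :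
    ((lowBose α β).sum fun i n => (n : M) * v i) =
      α * v (.ghost .plus 0) + β * v (.ghost .minus (-1)) := by
  classical
  rw [lowBose, Finsupp.sum_add_index' (by simp) (by intros; push_cast; rw [add_mul]),
    Finsupp.sum_single_index (by simp), Finsupp.sum_single_index (by simp)]

section Values

variable (T : Finset (Fin 2)) (α β : ℕ)

theorem charge_low : charge picMZ (lowFermi T, lowBose α β) = 1 - T.card + α - β := by
  rw [charge, sum_lowFermi]
  erw [sum_lowBose]
  rw [show vacCharge picMZ = 1 from rfl]
  simp [FermiMode.charge, BoseMode.charge, gammaCreates, level_picMZ_plus, level_picMZ_minus,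
    Sgn.val]
  ring

theorem charge_low_insert :
    charge picMZ (insert (.bc 0) (lowFermi T), lowBose α β) = 1 - T.card + α - β := by
  rw [← charge_low, charge, charge, Finset.sum_insert (bc_zero_notMem_lowFermi T)]
  simp [FermiMode.charge]

theorem ghostNumber_low : ghostNumber picMZ (lowFermi T, lowBose α β) = 1 + α + β := by
  rw [ghostNumber, sum_lowFermi]
  erw [sum_lowBose]
  simp [FermiMode.ghostNumber, BoseMode.ghostNumber, gammaCreates, level_picMZ_plus,
    level_picMZ_minus]
  ring

theorem ghostNumber_low_insert :
    ghostNumber picMZ (insert (.bc 0) (lowFermi T), lowBose α β) = 2 + α + β := by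
  have := ghostNumber_low T α β
  rw [ghostNumber] at this ⊢
  simp only [Finset.sum_insert (bc_zero_notMem_lowFermi T)]
  rw [show FermiMode.ghostNumber (.bc 0) = 1 from rfl]
  linarith

theorem weight_low : weight picMZ 0 (lowFermi T, lowBose α β) =
    ((T.card : ℝ) - α + β - 1) / 2 := by
  rw [weight_eq, sum_lowFermi]
  erw [sum_lowBose]
  have hv : vacWeight picMZ = 1 / 2 := by norm_num [vacWeight, picMZ]
  simp [FermiMode.energy, BoseMode.energy, gammaCreates, level_picMZ_plus, level_picMZ_minus, hv,
    Momentum.sq]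
  ring

theorem weight_low_insert : weight picMZ 0 (insert (.bc 0) (lowFermi T), lowBose α β) =
    ((T.card : ℝ) - α + β - 1) / 2 := by
  rw [← weight_low, weight_eq, weight_eq, Finset.sum_insert (bc_zero_notMem_lowFermi T)]
  simp [FermiMode.energy]

end Values

/-- Light occupations without `c_0`, neutral under `J_0`. -/
theorem mem_occF_picMZ_diff {e : Occ} : e ∈ occF picMZ 0 \ {e | .bc 0 ∈ e.1} ↔
    ∃ T α β, β + T.card = α + 1 ∧ e = (lowFermi T, lowBose α β) := by
  constructor
  · rintro ⟨he, h0⟩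
    obtain ⟨hS, hn⟩ := picMZ_low he
    have e1 : e = (lowFermi _, lowBose _ _) := Prod.ext (hS.eq_lowFermi h0) hn.eq_lowBose
    refine ⟨_, _, _, ?_, e1⟩
    have := he.2.1
    rw [e1, charge_low] at this
    omega
  -- On light states the weight is minus half the charge, so neutrality alone implies both
  -- conditions.
  · rintro ⟨T, α, β, h, rfl⟩
    have h' : (β : ℝ) + T.card = α + 1 := by exact_mod_cast h
    refine ⟨⟨?_, ?_, (lowFermi_isLow T).bct 0⟩, bc_zero_notMem_lowFermi T⟩
    · rw [weight_low]; linarith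
    · rw [charge_low]; omega

/-- Light occupations with `c_0`, neutral under `J_0`. -/
theorem mem_occF_picMZ_inter {e : Occ} : e ∈ occF picMZ 0 ∩ {e | .bc 0 ∈ e.1} ↔
    ∃ T α β, β + T.card = α + 1 ∧ e = (insert (.bc 0) (lowFermi T), lowBose α β) := by
  constructor
  · rintro ⟨he, h0⟩
    obtain ⟨hS, hn⟩ := picMZ_low he
    have e1 : e = (insert (.bc 0) (lowFermi _), lowBose _ _) := Prod.ext
      (by rw [← hS.erase_bc_zero.eq_lowFermi (by simp), Finset.insert_erase h0]) hn.eq_lowBose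
    refine ⟨_, _, _, ?_, e1⟩
    have := he.2.1
    rw [e1, charge_low_insert] at this
    omega
  · rintro ⟨T, α, β, h, rfl⟩
    have h' : (β : ℝ) + T.card = α + 1 := by exact_mod_cast h
    refine ⟨⟨?_, ?_, (insert_lowFermi_isLow T).bct 0⟩, Finset.mem_insert_self _ _⟩
    · rw [weight_low_insert]; linarith
    · rw [charge_low_insert]; omega

/-- Exchanging `c_0` for `γ^+_{1/2} γ^-_{-1/2}`. -/
noncomputable def shiftOcc (e : Occ) : Occ :=
  (e.1.erase (.bc 0),
    e.2 + Finsupp.single (.ghost .plus 0) 1 + Finsupp.single (.ghost .minus (-1)) 1)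

/-- Once `c_0` is known to have been occupied, reinserting it and removing the ghost pair undoes the
exchange. -/
theorem shiftOcc_injOn : Set.InjOn shiftOcc {e | .bc 0 ∈ e.1} := by
  rintro ⟨S, n⟩ h ⟨S', n'⟩ h' hs
  simp only [shiftOcc, Prod.mk.injEq] at hs
  refine Prod.ext ?_ (add_right_cancel (add_right_cancel hs.2))
  have := congrArg (insert (FermiMode.bc 0)) hs.1
  rwa [Finset.insert_erase h, Finset.insert_erase h'] at this

theorem lowBose_add (α β : ℕ) : lowBose α β + Finsupp.single (.ghost .plus 0) 1 +
    Finsupp.single (.ghost .minus (-1)) 1 = lowBose (α + 1) (β + 1) := by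
  simp only [lowBose, Finsupp.single_add]
  abel

theorem shiftOcc_low (T : Finset (Fin 2)) (α β : ℕ) :
    shiftOcc (insert (.bc 0) (lowFermi T), lowBose α β) =
      (lowFermi T, lowBose (α + 1) (β + 1)) := by
  rw [shiftOcc, Finset.erase_insert (bc_zero_notMem_lowFermi T), lowBose_add]

/-- Neutrality cancels the coefficients of `c_0` and `c̃_0`, which are the eigenvalues of `L_0` and
`J_0`. -/
theorem Q_picMZ_of_mem {e : Occ} (he : e ∈ occF picMZ 0 ∩ {e | .bc 0 ∈ e.1}) :
    Q picMZ 0 (Finsupp.single e 1) = Finsupp.single (shiftOcc e) (-4) := by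
  obtain ⟨T, α, β, h, rfl⟩ := mem_occF_picMZ_inter.1 he
  have h' : (β : ℂ) + T.card = α + 1 := by exact_mod_cast h
  rw [Q_picMZ_single (insert_lowFermi_isLow T) (lowBose_isLow α β), numPsi_insert,
    numPsi_lowFermi, lowBose_plus, lowBose_minus,
    if_pos (Finset.mem_insert_self _ _),
    show ((T.card : ℂ) - α + β - 1) / 2 = 0 by linear_combination h' / 2,
    show (1 : ℂ) - T.card + α - β = 0 by linear_combination -h', zero_smul, zero_smul, zero_add,
    zero_add]
  rfl

theorem Q_picMZ_of_notMem {e : Occ} (he : e ∈ occF picMZ 0 \ {e | .bc 0 ∈ e.1}) :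
    Q picMZ 0 (Finsupp.single e 1) = 0 := by
  obtain ⟨T, α, β, h, rfl⟩ := mem_occF_picMZ_diff.1 he
  have h' : (β : ℂ) + T.card = α + 1 := by exact_mod_cast h
  rw [Q_picMZ_single (lowFermi_isLow T) (lowBose_isLow α β), numPsi_lowFermi, lowBose_plus,
    lowBose_minus, if_neg (bc_zero_notMem_lowFermi T),
    show ((T.card : ℂ) - α + β - 1) / 2 = 0 by linear_combination h' / 2,
    show (1 : ℂ) - T.card + α - β = 0 by linear_combination -h', zero_smul, zero_smul,
    Finsupp.single_zero, add_zero, add_zero]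

/-! ### Closed and exact states -/

/-- The occupations spanning the closed states of the `(-1,0)` picture. -/
def closedMZ (g : ℤ) : Set Occ :=
  {e | ∃ (T : Finset (Fin 2)) (α β : ℕ), β + T.card = α + 1 ∧ g = 1 + α + β ∧ e = (lowFermi T, lowBose α β)}

/-- The occupations spanning the absolutely exact states of the `(-1,0)` picture. -/
def exactMZ (g : ℤ) : Set Occ :=
  {e | ∃ (T : Finset (Fin 2)) (α β : ℕ), β + T.card = α + 1 ∧ g = 3 + α + β ∧
    e = (lowFermi T, lowBose (α + 1) (β + 1))}

theorem closedMZ_eq (g : ℤ) : closedMZ g =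
    (occF picMZ 0 \ {e | .bc 0 ∈ e.1}) ∩ {e | ghostNumber picMZ e = g} := by
  ext e
  rw [Set.mem_inter_iff, mem_occF_picMZ_diff]
  constructor
  · rintro ⟨T, α, β, h, hg, rfl⟩
    exact ⟨⟨T, α, β, h, rfl⟩, by rw [Set.mem_ofPred_eq, ghostNumber_low, hg]⟩
  · rintro ⟨⟨T, α, β, h, rfl⟩, hg⟩
    rw [Set.mem_ofPred_eq, ghostNumber_low] at hg
    exact ⟨T, α, β, h, hg.symm, rfl⟩

theorem Frel_picMZ : Frel picMZ 0 = spanOcc (occF picMZ 0 \ {e | .bc 0 ∈ e.1}) :=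
  Frel_eq_spanOcc _ _

theorem Q_picMZ_Frel {ψ : Fock} (hψ : ψ ∈ Frel picMZ 0) : Q picMZ 0 ψ = 0 := by
  rw [Frel_picMZ] at hψ
  exact apply_eq_zero_of_mem_spanOcc (fun e he => Q_picMZ_of_notMem he) hψ

theorem cocycles_Frel_picMZ (g : ℤ) :
    cocycles picMZ 0 (Frel picMZ 0) g = spanOcc (closedMZ g) := by
  rw [closedMZ_eq, ← ghostPart_spanOcc, ← Frel_picMZ]
  exact inf_eq_left.2 fun ψ hψ => Q_picMZ_Frel hψ.1

theorem coboundaries_Frel_picMZ (g : ℤ) :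
    coboundaries picMZ 0 (Frel picMZ 0) g = spanOcc ∅ := by
  rw [coboundaries, Frel_picMZ, ghostPart_spanOcc, map_eq_bot fun e he => Q_picMZ_of_notMem he.1,
    spanOcc, Finsupp.supported_empty]

theorem cocycles_F_picMZ (g : ℤ) : cocycles picMZ 0 (F picMZ 0) g = spanOcc (closedMZ g) := by
  rw [cocycles, F_eq_spanOcc, ghostPart_spanOcc, spanOcc_inf_ker_of_shift
    (P := {e | .bc 0 ∈ e.1}) (σ := shiftOcc) (κ := -4) (by norm_num)
    (fun e he => Q_picMZ_of_mem ⟨he.1.1, he.2⟩)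
    (fun e he => Q_picMZ_of_notMem ⟨he.1.1, he.2⟩) (shiftOcc_injOn.mono fun e he => he.2),
    closedMZ_eq]
  congr 1
  ext e
  simp only [Set.mem_sdiff, Set.mem_inter_iff]
  tauto

theorem coboundaries_F_picMZ (g : ℤ) :
    coboundaries picMZ 0 (F picMZ 0) g = spanOcc (exactMZ g) := by
  rw [coboundaries, F_eq_spanOcc, ghostPart_spanOcc, map_spanOcc_of_shift
    (P := {e | .bc 0 ∈ e.1}) (σ := shiftOcc) (κ := -4) (by norm_num)
    (fun e he => Q_picMZ_of_mem ⟨he.1.1, he.2⟩)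
    (fun e he => Q_picMZ_of_notMem ⟨he.1.1, he.2⟩)]
  congr 1
  ext e
  constructor
  · rintro ⟨e, ⟨⟨he, hg⟩, h0⟩, rfl⟩
    obtain ⟨T, α, β, h, rfl⟩ := mem_occF_picMZ_inter.1 ⟨he, h0⟩
    rw [Set.mem_ofPred_eq, ghostNumber_low_insert] at hg
    exact ⟨T, α, β, h, by linarith, shiftOcc_low T α β⟩
  · rintro ⟨T, α, β, h, hg, rfl⟩
    obtain ⟨he, h0⟩ := mem_occF_picMZ_inter.2 ⟨T, α, β, h, rfl⟩
    refine ⟨_, ⟨⟨he, ?_⟩, h0⟩, shiftOcc_low T α β⟩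
    rw [Set.mem_ofPred_eq, ghostNumber_low_insert]
    linarith

theorem exactMZ_subset (g : ℤ) : exactMZ g ⊆ closedMZ g := by
  rintro _ ⟨T, α, β, h, hg, rfl⟩
  exact ⟨T, α + 1, β + 1, by omega, by push_cast; linarith, rfl⟩

/-! ### The `(-1,-1)` picture -/

theorem Q_picMM_F {k : Momentum} (hk : k.sq = 0) {e : Occ} (he : e ∈ occF picMM k) :
    Q picMM k (Finsupp.single e 1) = 0 := by
  rw [occF_picMM hk] at he
  rcases he with rfl | rfl <;> refine Q_picMM_single hk ?_ (by simp) <;>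
    constructor <;> simp +contextual

/-- The occupations spanning the relatively closed states of the `(-1,-1)` picture. -/
def closedRelMM (g : ℤ) : Set Occ := {e | g = 1 ∧ e = occC}

/-- The occupations spanning the absolutely closed states of the `(-1,-1)` picture. -/
def closedMM (g : ℤ) : Set Occ := {e | (g = 1 ∧ e = occC) ∨ (g = 2 ∧ e = occCC)}

theorem ghostNumber_occC : ghostNumber picMM occC = 1 := by
  simp [ghostNumber, occC, FermiMode.ghostNumber]

theorem ghostNumber_occCC : ghostNumber picMM occCC = 2 := by
  simp [ghostNumber, occCC, FermiMode.ghostNumber]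

theorem cocycles_F_picMM {k : Momentum} (hk : k.sq = 0) (g : ℤ) :
    cocycles picMM k (F picMM k) g = spanOcc (closedMM g) := by
  have h : ghostPart picMM (F picMM k) g = spanOcc (closedMM g) := by
    rw [F_eq_spanOcc, ghostPart_spanOcc, occF_picMM hk]
    congr 1
    ext e
    constructor
    · rintro ⟨rfl | rfl, hg⟩
      · exact .inl ⟨hg.symm.trans ghostNumber_occC, rfl⟩
      · exact .inr ⟨hg.symm.trans ghostNumber_occCC, rfl⟩
    · rintro (⟨rfl, rfl⟩ | ⟨rfl, rfl⟩)
      · exact ⟨.inl rfl, ghostNumber_occC⟩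
      · exact ⟨.inr rfl, ghostNumber_occCC⟩
  rw [cocycles, ← h]
  refine inf_eq_left.2 fun ψ hψ => ?_
  have := hψ.1
  rw [F_eq_spanOcc] at this
  exact apply_eq_zero_of_mem_spanOcc (fun e he => Q_picMM_F hk he) this

theorem coboundaries_F_picMM {k : Momentum} (hk : k.sq = 0) (g : ℤ) :
    coboundaries picMM k (F picMM k) g = spanOcc ∅ := by
  rw [coboundaries, F_eq_spanOcc, ghostPart_spanOcc, map_eq_bot fun e he => Q_picMM_F hk he.1,
    spanOcc, Finsupp.supported_empty]

theorem cocycles_Frel_picMM {k : Momentum} (hk : k.sq = 0) (g : ℤ) :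
    cocycles picMM k (Frel picMM k) g = spanOcc (closedRelMM g) := by
  have h : cocycles picMM k (Frel picMM k) g =
      cocycles picMM k (F picMM k) g ⊓ LinearMap.ker (b 0) := by
    simp only [cocycles, ghostPart, Frel]
    ac_rfl
  have hb : b 0 = annihF (.bc 0) := by simp [b]
  rw [h, cocycles_F_picMM hk, hb, ker_annihF, spanOcc_inf]
  congr 1
  ext e
  constructor
  · rintro ⟨⟨rfl, rfl⟩ | ⟨rfl, rfl⟩, h0⟩
    · exact ⟨rfl, rfl⟩
    · exact (h0 (by simp [occCC])).elim
  · rintro ⟨rfl, rfl⟩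
    exact ⟨.inl ⟨rfl, rfl⟩, by simp [occC]⟩

theorem coboundaries_Frel_picMM {k : Momentum} (hk : k.sq = 0) (g : ℤ) :
    coboundaries picMM k (Frel picMM k) g = spanOcc ∅ := by
  rw [coboundaries, Frel_eq_spanOcc, ghostPart_spanOcc,
    map_eq_bot fun e he => Q_picMM_F hk he.1.1, spanOcc, Finsupp.supported_empty]

/-! ### The named states as basis states -/

theorem gam_pow_single {π : Picture} {s : Sgn} {j : ℤ} (hj : gammaCreates π s j) (N : ℕ)
    (S : Finset FermiMode) (n : BoseMode →₀ ℕ) (z : ℂ) :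
    (gam π s j ^ N) (Finsupp.single (S, n) z) =
      Finsupp.single (S, n + Finsupp.single (.ghost s j) N) z := by
  induction N with
  | zero => simp
  | succ N ih =>
    rw [pow_succ', Module.End.mul_apply, ih, gam, if_pos hj, createB_single, add_assoc,
      ← Finsupp.single_add]

theorem c_one_single {S : Finset FermiMode} (hS : ∀ j ∈ S, .bc 1 < j) (n : BoseMode →₀ ℕ)
    (z : ℂ) : c 1 (Finsupp.single (S, n) z) = Finsupp.single (insert (.bc 1) S, n) z := by
  rw [c, if_pos le_rfl, createF_single, if_neg fun h => lt_irrefl _ (hS _ h),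
    fermiSign_eq_one fun j hj => (hS j hj).le.not_gt, mul_one]

/-- `c_1 (γ^+_{1/2})^α (γ^-_{-1/2})^β` acting on excited matter fermions. -/
theorem c_gam_gam_single (α β : ℕ) (T : Finset (Fin 2)) :
    c 1 ((gam picMZ .plus 0 ^ α) ((gam picMZ .minus (-1) ^ β)
      (Finsupp.single (T.image fun μ => .psi .minus μ 0, 0) 1))) =
        Finsupp.single (lowFermi T, lowBose α β) 1 := by
  rw [gam_pow_single (by decide), gam_pow_single (by decide), c_one_single, lowFermi, lowBose,
    zero_add, add_comm]
  intro j hj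
  obtain ⟨μ, -, rfl⟩ := Finset.mem_image.1 hj
  exact bc_lt_psi_minus _ _ _

theorem d_minus_vac (μ : Fin 2) : d .minus μ (-1) vac =
    Finsupp.single ({.psi .minus μ 0}, 0) 1 := by
  show createF (.psi .minus μ 0) (Finsupp.single _ _) = _
  rw [createF_single, if_neg (Finset.notMem_empty _), fermiSign_eq_one (by simp), mul_one,
    insert_empty_eq]

/-- The occupations of `A_N^μ`. -/
noncomputable def occA (N : ℕ) (μ : Fin 2) : Occ := (lowFermi {μ}, lowBose N N)

theorem stateA_eq (N : ℕ) (μ : Fin 2) : stateA N μ = Finsupp.single (occA N μ) 1 := by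
  simp only [occA, stateA, Module.End.mul_apply, d_minus_vac]
  rw [← c_gam_gam_single, Finset.image_singleton]

theorem stateB_eq (N : ℕ) : stateB N = Finsupp.single (lowFermi ∅, lowBose N (N + 1)) 1 := by
  simp only [stateB, Module.End.mul_apply, vac]
  rw [← c_gam_gam_single, Finset.image_empty]

theorem stateC_eq (N : ℕ) : stateC N 0 1 =
    Finsupp.single (lowFermi Finset.univ, lowBose (N + 1) N) 1 := by
  have h : d .minus 0 (-1) (d .minus 1 (-1) vac) = Finsupp.single
      ((Finset.univ : Finset (Fin 2)).image fun μ => FermiMode.psi .minus μ 0, 0) 1 := by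
    rw [d_minus_vac]
    show createF (.psi .minus 0 0) (Finsupp.single _ _) = _
    -- The fermion with `μ = 0` precedes the one with `μ = 1` in the order, so `C_N` carries no
    -- sign.
    rw [createF_single, if_neg (by simp), fermiSign_eq_one, mul_one]
    · rfl
    · intro j hj
      rw [Finset.mem_singleton] at hj
      subst hj
      show ¬ toLex (4 + 1, (0 : ℤ)) < toLex (4 + 0, (0 : ℤ))
      simp [Prod.Lex.toLex_lt_toLex]
  simp only [stateC, Module.End.mul_apply, h]
  rw [← c_gam_gam_single]

theorem c_one_vac : c 1 vac = Finsupp.single occC 1 := by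
  rw [vac, c_one_single (by simp)]
  rfl

theorem c_zero_c_one_vac : c 0 (c 1 vac) = Finsupp.single occCC 1 := by
  rw [c_one_vac, occC, c, if_pos (by omega), createF_single, if_neg (by simp), fermiSign_eq_one,
    mul_one]
  · rfl
  · simpa using bc_zero_lt_bc_one.le

theorem lowOcc_inj {T T' : Finset (Fin 2)} {α β α' β' : ℕ}
    (h : ((lowFermi T, lowBose α β) : Occ) = (lowFermi T', lowBose α' β')) :
    T = T' ∧ α = α' ∧ β = β' :=
  ⟨lowFermi_injective (congrArg Prod.fst h), lowBose_inj (congrArg Prod.snd h)⟩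

/-- The occupations of `B_N` and `C_N`. -/
noncomputable def occBC (N : ℕ) : Fin 2 → Occ :=
  ![(lowFermi ∅, lowBose N (N + 1)), (lowFermi Finset.univ, lowBose (N + 1) N)]

theorem occA_injective (N : ℕ) : Function.Injective (occA N) := fun μ ν h => by
  simpa using (lowOcc_inj h).1

theorem occBC_injective (N : ℕ) : Function.Injective (occBC N) := by
  intro i j h
  fin_cases i <;> fin_cases j
  · rfl
  · have := (lowOcc_inj h).2.1
    omega
  · have := (lowOcc_inj h).2.1
    omega
  · rfl

theorem finset_fin_two (T : Finset (Fin 2)) :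
    (T.card = 0 ∧ T = ∅) ∨ (T.card = 1 ∧ ∃ μ, T = {μ}) ∨ (T.card = 2 ∧ T = Finset.univ) := by
  have h : T.card ≤ 2 := (Finset.card_le_univ T).trans_eq (Fintype.card_fin 2)
  interval_cases hT : T.card
  · exact .inl ⟨rfl, Finset.card_eq_zero.1 hT⟩
  · exact .inr (.inl ⟨rfl, Finset.card_eq_one.1 hT⟩)
  · exact .inr (.inr ⟨rfl, (Finset.card_eq_iff_eq_univ T).1 (by rw [hT, Fintype.card_fin])⟩)

/-- The difference `β - α = 1 - |T|` takes the values `1, 0, -1`, and `g = 1 + α + β`. Hence odd `g`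
forces one matter fermion, and even `g` none or both. -/
theorem mem_closedMZ_iff {g : ℤ} {e : Occ} : e ∈ closedMZ g ↔
    (∃ N : ℕ, g = 2 * N + 1 ∧ e ∈ Set.range (occA N)) ∨
      ∃ N : ℕ, g = 2 * N + 2 ∧ e ∈ Set.range (occBC N) := by
  constructor
  · rintro ⟨T, α, β, h, hg, rfl⟩
    rcases finset_fin_two T with ⟨hT, rfl⟩ | ⟨hT, μ, rfl⟩ | ⟨hT, rfl⟩
    · obtain rfl : β = α + 1 := by omega
      exact .inr ⟨α, by push_cast at hg; linarith, 0, rfl⟩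
    · obtain rfl : β = α := by omega
      exact .inl ⟨β, by linarith, μ, rfl⟩
    · obtain rfl : α = β + 1 := by omega
      exact .inr ⟨β, by push_cast at hg; linarith, 1, rfl⟩
  · rintro (⟨N, rfl, μ, rfl⟩ | ⟨N, rfl, i, rfl⟩)
    · exact ⟨{μ}, N, N, by simp, by ring, rfl⟩
    · fin_cases i
      · exact ⟨∅, N, N + 1, by simp, by push_cast; ring, rfl⟩
      · exact ⟨Finset.univ, N + 1, N, by simp, by push_cast; ring, rfl⟩

theorem mem_closedMZ_odd {N : ℕ} {e : Occ} :
    e ∈ closedMZ (2 * N + 1) ↔ e ∈ Set.range (occA N) := by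
  rw [mem_closedMZ_iff]
  constructor
  · rintro (⟨M, h, he⟩ | ⟨M, h, he⟩)
    · obtain rfl : N = M := by omega
      exact he
    · omega
  · exact fun he => .inl ⟨N, rfl, he⟩

theorem mem_closedMZ_even {N : ℕ} {e : Occ} :
    e ∈ closedMZ (2 * N + 2) ↔ e ∈ Set.range (occBC N) := by
  rw [mem_closedMZ_iff]
  constructor
  · rintro (⟨M, h, he⟩ | ⟨M, h, he⟩)
    · omega
    · obtain rfl : N = M := by omega
      exact he
  · exact fun he => .inr ⟨N, rfl, he⟩

theorem exactMZ_eq_empty {g : ℤ} (hg : g ≤ 2) : exactMZ g = ∅ := by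
  ext e
  simp only [Set.mem_empty_iff_false, iff_false]
  rintro ⟨T, α, β, h, hg', rfl⟩
  obtain ⟨rfl, rfl⟩ : α = 0 ∧ β = 0 := by omega
  omega

/-- A closed state is exact as soon as `α` and `β` are both positive. If either is zero, neutrality
with `|T| ≤ 2` bounds the other by `1`, which means `g = 1` or `g = 2`. -/
theorem closedMZ_subset_exactMZ {g : ℤ} (h1 : g ≠ 1) (h2 : g ≠ 2) : closedMZ g ⊆ exactMZ g := by
  rintro _ ⟨T, α, β, h, hg, rfl⟩
  have hT : T.card ≤ 2 := (Finset.card_le_univ T).trans_eq (Fintype.card_fin 2)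
  obtain ⟨α, rfl⟩ : ∃ α', α = α' + 1 := ⟨α - 1, by omega⟩
  obtain ⟨β, rfl⟩ : ∃ β', β = β' + 1 := ⟨β - 1, by omega⟩
  exact ⟨T, α, β, by omega, by push_cast at hg; linarith, rfl⟩

/-! ### Bases, dimensions and vanishing of the cohomologies -/

theorem classesFormBasis_Frel_picMZ_odd (N : ℕ) :
    ClassesFormBasis picMZ 0 (Frel picMZ 0) (2 * N + 1) fun μ : Fin 2 => stateA N μ := by
  simp only [stateA_eq]
  exact classesFormBasis_of_spanOcc (cocycles_Frel_picMZ _) (coboundaries_Frel_picMZ _)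
    (occA_injective N) fun e => by rw [Set.sdiff_empty, mem_closedMZ_odd]

theorem stateBC_eq (N : ℕ) :
    ![stateB N, stateC N 0 1] = fun i => Finsupp.single (occBC N i) 1 := by
  rw [stateB_eq, stateC_eq]
  ext1 i
  fin_cases i <;> rfl

theorem classesFormBasis_Frel_picMZ_even (N : ℕ) :
    ClassesFormBasis picMZ 0 (Frel picMZ 0) (2 * N + 2) ![stateB N, stateC N 0 1] := by
  rw [stateBC_eq]
  exact classesFormBasis_of_spanOcc (cocycles_Frel_picMZ _) (coboundaries_Frel_picMZ _)
    (occBC_injective N) fun e => by rw [Set.sdiff_empty, mem_closedMZ_even]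

theorem classesFormBasis_F_picMZ_one :
    ClassesFormBasis picMZ 0 (F picMZ 0) 1 fun μ : Fin 2 => stateA 0 μ := by
  simp only [stateA_eq]
  refine classesFormBasis_of_spanOcc (cocycles_F_picMZ _) (coboundaries_F_picMZ _)
    (occA_injective 0) fun e => ?_
  rw [exactMZ_eq_empty (by norm_num), Set.sdiff_empty, ← mem_closedMZ_odd]
  norm_num

theorem classesFormBasis_F_picMZ_two :
    ClassesFormBasis picMZ 0 (F picMZ 0) 2 ![stateB 0, stateC 0 0 1] := by
  rw [stateBC_eq]
  refine classesFormBasis_of_spanOcc (cocycles_F_picMZ _) (coboundaries_F_picMZ _)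
    (occBC_injective 0) fun e => ?_
  rw [exactMZ_eq_empty (by norm_num), Set.sdiff_empty, ← mem_closedMZ_even]
  norm_num

theorem rank_coh_Frel_picMZ {g : ℤ} (hg : 1 ≤ g) :
    Module.rank ℂ (Coh picMZ 0 (Frel picMZ 0) g) = 2 := by
  obtain ⟨N, rfl | rfl⟩ : ∃ N : ℕ, g = 2 * N + 1 ∨ g = 2 * N + 2 :=
    ⟨((g - 1) / 2).toNat, by omega⟩
  · rw [(classesFormBasis_Frel_picMZ_odd N).rank_eq]; simp
  · rw [(classesFormBasis_Frel_picMZ_even N).rank_eq]; simp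

theorem classesFormBasis_Frel_picMM {k : Momentum} (hk : k.sq = 0) :
    ClassesFormBasis picMM k (Frel picMM k) 1 fun _ : Unit => c 1 vac := by
  simp only [c_one_vac]
  refine classesFormBasis_of_spanOcc (cocycles_Frel_picMM hk _) (coboundaries_Frel_picMM hk _)
    (Function.injective_of_subsingleton _) fun e => ?_
  simp [closedRelMM]

theorem subsingleton_coh_Frel_picMM {k : Momentum} (hk : k.sq = 0) {g : ℤ}
    (hg : g ≠ 1) :
    Subsingleton (Coh picMM k (Frel picMM k) g) :=
  subsingleton_coh_of_spanOcc (cocycles_Frel_picMM hk _) (coboundaries_Frel_picMM hk _)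
    fun _ he => (hg he.1).elim

theorem classesFormBasis_F_picMM_one {k : Momentum} (hk : k.sq = 0) :
    ClassesFormBasis picMM k (F picMM k) 1 fun _ : Unit => c 1 vac := by
  simp only [c_one_vac]
  refine classesFormBasis_of_spanOcc (cocycles_F_picMM hk _) (coboundaries_F_picMM hk _)
    (Function.injective_of_subsingleton _) fun e => ?_
  simp [closedMM]

theorem classesFormBasis_F_picMM_two {k : Momentum} (hk : k.sq = 0) :
    ClassesFormBasis picMM k (F picMM k) 2 fun _ : Unit => c 0 (c 1 vac) := by
  simp only [c_zero_c_one_vac]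
  refine classesFormBasis_of_spanOcc (cocycles_F_picMM hk _) (coboundaries_F_picMM hk _)
    (Function.injective_of_subsingleton _) fun e => ?_
  simp [closedMM]

theorem subsingleton_coh_F_picMM {k : Momentum} (hk : k.sq = 0) {g : ℤ}
    (h1 : g ≠ 1) (h2 : g ≠ 2) :
    Subsingleton (Coh picMM k (F picMM k) g) :=
  subsingleton_coh_of_spanOcc (cocycles_F_picMM hk _) (coboundaries_F_picMM hk _)
    fun _ he => he.elim (fun h => (h1 h.1).elim) fun h => (h2 h.1).elim

theorem isEmpty_linearEquiv_of_rank {V W : Type} [AddCommGroup V] [AddCommGroup W] [Module ℂ V]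
    [Module ℂ W] (hV : Module.rank ℂ V = 2) (hW : Module.rank ℂ W ≤ 1) :
    IsEmpty (V ≃ₗ[ℂ] W) := by
  refine ⟨fun e => ?_⟩
  rw [← e.rank_eq, hV] at hW
  exact absurd hW (by norm_num)

theorem spanOcc_empty_le (V : Submodule ℂ Fock) : spanOcc ∅ ≤ V := by
  rw [spanOcc, Finsupp.supported_empty]
  exact bot_le

end N2String

/-! ### Assembling the result -/

theorem mainTheorem6 :
    -- the spaces below are complexes, so that their BRST cohomology is defined
    (N2String.IsBRSTComplex N2String.picMZ 0 (N2String.F N2String.picMZ 0) ∧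
      N2String.IsBRSTComplex N2String.picMZ 0 (N2String.Frel N2String.picMZ 0) ∧
      ∀ k : N2String.Momentum, k.sq = 0 →
        N2String.IsBRSTComplex N2String.picMM k (N2String.F N2String.picMM k) ∧
        N2String.IsBRSTComplex N2String.picMM k (N2String.Frel N2String.picMM k)) ∧
    -- picture (-1,0), zero momentum, relative: the BRST charge vanishes,
    -- and the cohomology is two-dimensional at every positive ghost number and zero elsewhere
    (∀ ψ ∈ N2String.Frel N2String.picMZ 0, N2String.Q N2String.picMZ 0 ψ = 0) ∧
    (∀ g : ℤ, 1 ≤ g →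
      Module.rank ℂ (N2String.Coh N2String.picMZ 0 (N2String.Frel N2String.picMZ 0) g) = 2) ∧
    (∀ g : ℤ, g ≤ 0 →
      Subsingleton (N2String.Coh N2String.picMZ 0 (N2String.Frel N2String.picMZ 0) g)) ∧
    (∀ N : ℕ,
      N2String.ClassesFormBasis N2String.picMZ 0 (N2String.Frel N2String.picMZ 0) (2 * N + 1)
        (fun μ : Fin 2 => N2String.stateA N μ) ∧
      N2String.ClassesFormBasis N2String.picMZ 0 (N2String.Frel N2String.picMZ 0) (2 * N + 2)
        ![N2String.stateB N, N2String.stateC N 0 1]) ∧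
    -- picture (-1,0), zero momentum, absolute
    N2String.ClassesFormBasis N2String.picMZ 0 (N2String.F N2String.picMZ 0) 1
      (fun μ : Fin 2 => N2String.stateA 0 μ) ∧
    N2String.ClassesFormBasis N2String.picMZ 0 (N2String.F N2String.picMZ 0) 2
      ![N2String.stateB 0, N2String.stateC 0 0 1] ∧
    (∀ g : ℤ, g ≠ 1 → g ≠ 2 →
      Subsingleton (N2String.Coh N2String.picMZ 0 (N2String.F N2String.picMZ 0) g)) ∧
    -- picture (-1,-1), every null momentum including zero: one state c_1 in the relative
    -- cohomology, and the two states c_1 and c_0 c_1 in the absolute cohomology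
    (∀ k : N2String.Momentum, k.sq = 0 →
      N2String.ClassesFormBasis N2String.picMM k (N2String.Frel N2String.picMM k) 1
        (fun _ : Unit => N2String.c 1 N2String.vac) ∧
      (∀ g : ℤ, g ≠ 1 →
        Subsingleton (N2String.Coh N2String.picMM k (N2String.Frel N2String.picMM k) g)) ∧
      N2String.ClassesFormBasis N2String.picMM k (N2String.F N2String.picMM k) 1
        (fun _ : Unit => N2String.c 1 N2String.vac) ∧
      N2String.ClassesFormBasis N2String.picMM k (N2String.F N2String.picMM k) 2
        (fun _ : Unit => N2String.c 0 (N2String.c 1 N2String.vac)) ∧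
      (∀ g : ℤ, g ≠ 1 → g ≠ 2 →
        Subsingleton (N2String.Coh N2String.picMM k (N2String.F N2String.picMM k) g))) ∧
    -- identifying the oscillator states over |-1,-1,k⟩ with those over |-1,-1,0⟩, the closed and
    -- the exact states at a null momentum are those at zero momentum
    (∀ k : N2String.Momentum, k.sq = 0 → ∀ g : ℤ,
      N2String.cocycles N2String.picMM k (N2String.Frel N2String.picMM k) g =
        N2String.cocycles N2String.picMM 0 (N2String.Frel N2String.picMM 0) g ∧
      N2String.coboundaries N2String.picMM k (N2String.Frel N2String.picMM k) g =
        N2String.coboundaries N2String.picMM 0 (N2String.Frel N2String.picMM 0) g ∧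
      N2String.cocycles N2String.picMM k (N2String.F N2String.picMM k) g =
        N2String.cocycles N2String.picMM 0 (N2String.F N2String.picMM 0) g ∧
      N2String.coboundaries N2String.picMM k (N2String.F N2String.picMM k) g =
        N2String.coboundaries N2String.picMM 0 (N2String.F N2String.picMM 0) g) ∧
    -- picture dependence at zero momentum
    (∀ g : ℤ, 1 ≤ g → IsEmpty
      (N2String.Coh N2String.picMZ 0 (N2String.Frel N2String.picMZ 0) g ≃ₗ[ℂ]
        N2String.Coh N2String.picMM 0 (N2String.Frel N2String.picMM 0) g)) ∧
    (∀ g : ℤ, g = 1 ∨ g = 2 → IsEmpty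
      (N2String.Coh N2String.picMZ 0 (N2String.F N2String.picMZ 0) g ≃ₗ[ℂ]
        N2String.Coh N2String.picMM 0 (N2String.F N2String.picMM 0) g)) := by
  open N2String in
  have hk0 : Momentum.sq 0 = 0 := by simp [Momentum.sq]
  refine ⟨⟨?_, ?_, fun k hk => ⟨?_, ?_⟩⟩, fun ψ hψ => Q_picMZ_Frel hψ,
    fun g hg => rank_coh_Frel_picMZ hg, fun g hg => ?_,
    fun N => ⟨classesFormBasis_Frel_picMZ_odd N, classesFormBasis_Frel_picMZ_even N⟩,
    classesFormBasis_F_picMZ_one, classesFormBasis_F_picMZ_two, fun g h1 h2 => ?_,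
    fun k hk => ⟨classesFormBasis_Frel_picMM hk, fun g hg => subsingleton_coh_Frel_picMM hk hg,
      classesFormBasis_F_picMM_one hk, classesFormBasis_F_picMM_two hk,
      fun g h1 h2 => subsingleton_coh_F_picMM hk h1 h2⟩,
    fun k hk g => ⟨?_, ?_, ?_, ?_⟩, fun g hg => ?_, fun g hg => ?_⟩
  · refine isBRSTComplex_of_le fun g => ?_
    rw [cocycles_F_picMZ, coboundaries_F_picMZ]
    exact Finsupp.supported_mono (exactMZ_subset g)
  · refine isBRSTComplex_of_le fun g => ?_
    rw [coboundaries_Frel_picMZ]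
    exact spanOcc_empty_le _
  · refine isBRSTComplex_of_le fun g => ?_
    rw [coboundaries_F_picMM hk]
    exact spanOcc_empty_le _
  · refine isBRSTComplex_of_le fun g => ?_
    rw [coboundaries_Frel_picMM hk]
    exact spanOcc_empty_le _
  · refine subsingleton_coh_of_spanOcc (cocycles_Frel_picMZ g) (coboundaries_Frel_picMZ g) ?_
    rintro _ ⟨T, α, β, -, h, rfl⟩
    -- Closed light states have `g = 1 + α + β ≥ 1`.
    omega
  · exact subsingleton_coh_of_spanOcc (cocycles_F_picMZ g) (coboundaries_F_picMZ g)
      (closedMZ_subset_exactMZ h1 h2)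
  · rw [cocycles_Frel_picMM hk, cocycles_Frel_picMM hk0]
  · rw [coboundaries_Frel_picMM hk, coboundaries_Frel_picMM hk0]
  · rw [cocycles_F_picMM hk, cocycles_F_picMM hk0]
  · rw [coboundaries_F_picMM hk, coboundaries_F_picMM hk0]
  · refine isEmpty_linearEquiv_of_rank (rank_coh_Frel_picMZ hg) ?_
    by_cases h1 : g = 1
    · rw [h1, (classesFormBasis_Frel_picMM hk0).rank_eq]
      simp
    · have := subsingleton_coh_Frel_picMM hk0 h1
      rw [rank_subsingleton']
      exact zero_le_one
  · rcases hg with rfl | rfl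
    · exact isEmpty_linearEquiv_of_rank
        (by rw [classesFormBasis_F_picMZ_one.rank_eq]; simp)
        (by rw [(classesFormBasis_F_picMM_one hk0).rank_eq]; simp)
    · exact isEmpty_linearEquiv_of_rank
        (by rw [classesFormBasis_F_picMZ_two.rank_eq]; simp)
        (by rw [(classesFormBasis_F_picMM_two hk0).rank_eq]; simp)
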